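/- \textbf{Problem.} In \textsc{Bicluster Editing with One-Sided Vertex Splitting} (BCEOVS) we are given a finite bipartite graph $G=(A,B,E)$ and a positive integer $k$. The question is whether $G$ can be turned into a disjoint union of bicliques by a sequence of at most $k$ operations, each of which adds an edge between a vertex of $A$ and a vertex of $B$, deletes an edge, or splits a vertex $b\in B$, that is, replaces $b$ by two vertices $b_1,b_2$ of $B$ with $N(b_1)\cup N(b_2)=N(b)$. (The sets $N(b_1),N(b_2)$ may overlap or be empty; an isolated vertex counts as a biclique.) \textbf{Theorem.} BCEOVS, parameterized by $k$, has a kernel with at most $7k^5=O(k^5)$ vertices: there is an algorithm which, given an instance $(G,k)$ with $k\ge 1$, computes in time polynomial in $|V(G)|+k$ a bipartite graph $G'=(A',B',E')$ with at most $7k^5$ vertices such that $(G',k)$ is a yes-instance of BCEOVS if and only if $(G,k)$ is. Consequently BCEOVS is fixed-parameter tractable: for some computable function $f$ and some constant $c$, there is an algorithm which decides every instance $(G,k)$ in time $f(k)\cdot(|V(G)|+k)^{c}$. (Algorithms are programs of a random access machine with unit cost per instruction, whose arithmetic instructions are addition and truncated subtraction of natural numbers. The graph is given by its biadjacency matrix.)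 -/

import Mathlib

/-! ### Bipartite graphs, edge editions, one-sided vertex splitting -/

/-- A finite bipartite graph `G = (A, B, E)`, with `A = {0, …, numA - 1}`, `B = {0, …, numB - 1}`
(two disjoint sets of vertices), and `a ∈ A`, `b ∈ B` joined by an edge iff `adj a b = true`. -/
structure BipGraph where
  numA : ℕ
  numB : ℕ
  adj : Fin numA → Fin numB → Bool

namespace BipGraph

/-- The number of vertices. -/
def order (G : BipGraph) : ℕ := G.numA + G.numB

/-- The graph `G + ab`. -/
def addEdge (G : BipGraph) (a : Fin G.numA) (b : Fin G.numB) : BipGraph where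
  numA := G.numA
  numB := G.numB
  adj x y := if x = a ∧ y = b then true else G.adj x y

/-- The graph `G - ab`. -/
def deleteEdge (G : BipGraph) (a : Fin G.numA) (b : Fin G.numB) : BipGraph where
  numA := G.numA
  numB := G.numB
  adj x y := if x = a ∧ y = b then false else G.adj x y

/-- The graph in which `b ∈ B` is replaced by two copies with neighborhoods `S` and `T`: the first
copy keeps the label `b`, the second one gets the new label `numB`. -/
def splitVertex (G : BipGraph) (b : Fin G.numB) (S T : Fin G.numA → Bool) : BipGraph where
  numA := G.numA
  numB := G.numB + 1
  adj x := Fin.snoc (α := fun _ => Bool) (fun y : Fin G.numB => if y = b then S x else G.adj x y)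
    (T x)

/-- One operation: an edge addition, an edge deletion, or the splitting of a vertex `b` of `B` into
two copies whose neighborhoods have union `N(b)` (they need not be disjoint). -/
inductive Edit : BipGraph → BipGraph → Prop
  | add (G : BipGraph) (a : Fin G.numA) (b : Fin G.numB) (h : G.adj a b = false) :
      Edit G (G.addEdge a b)
  | delete (G : BipGraph) (a : Fin G.numA) (b : Fin G.numB) (h : G.adj a b = true) :
      Edit G (G.deleteEdge a b)
  | split (G : BipGraph) (b : Fin G.numB) (S T : Fin G.numA → Bool)
      (h : ∀ a, G.adj a b = true ↔ S a = true ∨ T a = true) :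
      Edit G (G.splitVertex b S T)

/-- `EditSeq l G H`: some sequence of exactly `l` operations turns `G` into `H`. -/
inductive EditSeq : ℕ → BipGraph → BipGraph → Prop
  | nil (G : BipGraph) : EditSeq 0 G G
  | cons {l : ℕ} {G H K : BipGraph} (h : Edit G H) (hs : EditSeq l H K) : EditSeq (l + 1) G K

/-- `G` is a disjoint union of bicliques: its vertices can be distributed over blocks so that
`a ∈ A` and `b ∈ B` are adjacent iff they lie in the same block. -/
def IsDisjointUnionOfBicliques (G : BipGraph) : Prop :=
  ∃ (f : Fin G.numA → ℕ) (g : Fin G.numB → ℕ), ∀ a b, G.adj a b = true ↔ f a = g b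

end BipGraph

/-- Bicluster Editing with One-Sided Vertex Splitting: can `G = (A, B, E)` be turned into a disjoint
union of bicliques by at most `k` edge additions, edge deletions and splittings of vertices of `B`? -/
def BCEOVS (G : BipGraph) (k : ℕ) : Prop :=
  ∃ (l : ℕ) (H : BipGraph), l ≤ k ∧ BipGraph.EditSeq l G H ∧ H.IsDisjointUnionOfBicliques

/-! ### Random access machines

Structured programs for a random access machine with unit cost per instruction. The only arithmetic
instructions are addition and subtraction, so that after `t` steps every number in the memory has at
most `t` bits more than the largest number of the input and the program, and polynomial time is
the same as polynomial time on a Turing machine. -/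

namespace RAM

/-- A memory content: scalar variables and arrays of natural numbers, both named by natural
numbers (a program mentions only finitely many names). -/
structure State where
  var : ℕ → ℕ
  arr : ℕ → ℕ → ℕ

/-- Programs. Below, `x y z` are names of variables and `t` is the name of an array.
* `const x c`: `x := c`
* `add x y z`: `x := y + z`
* `sub x y z`: `x := max (y - z) 0`
* `read x t y`: `x := t[y]`
* `write t x y`: `t[x] := y`
* `ite x p q`: if `x ≠ 0` then `p` else `q`
* `loop x p`: while `x ≠ 0` do `p` -/
inductive Prog where
  | const (x c : ℕ)
  | add (x y z : ℕ)
  | sub (x y z : ℕ)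
  | read (x t y : ℕ)
  | write (t x y : ℕ)
  | seq (p q : Prog)
  | ite (x : ℕ) (p q : Prog)
  | loop (x : ℕ) (p : Prog)

/-- The state after `x := v`. -/
def State.setVar (s : State) (x v : ℕ) : State :=
  { s with var := Function.update s.var x v }

/-- The state after `t[i] := v`. -/
def State.setArr (s : State) (t i v : ℕ) : State :=
  { s with arr := Function.update s.arr t (Function.update (s.arr t) i v) }

/-- `Runs p s n s'`: started in the state `s`, the program `p` halts after exactly `n` steps in the
state `s'`. Every basic instruction and every test counts as one step. -/
inductive Runs : Prog → State → ℕ → State → Prop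
  | const (s : State) (x c : ℕ) : Runs (.const x c) s 1 (s.setVar x c)
  | add (s : State) (x y z : ℕ) : Runs (.add x y z) s 1 (s.setVar x (s.var y + s.var z))
  | sub (s : State) (x y z : ℕ) : Runs (.sub x y z) s 1 (s.setVar x (s.var y - s.var z))
  | read (s : State) (x t y : ℕ) : Runs (.read x t y) s 1 (s.setVar x (s.arr t (s.var y)))
  | write (s : State) (t x y : ℕ) : Runs (.write t x y) s 1 (s.setArr t (s.var x) (s.var y))
  | seq {p q : Prog} {s s' s'' : State} {n n' : ℕ} (h : Runs p s n s') (h' : Runs q s' n' s'') :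
      Runs (.seq p q) s (n + n') s''
  | ite_true {x : ℕ} {p q : Prog} {s s' : State} {n : ℕ} (hx : s.var x ≠ 0) (h : Runs p s n s') :
      Runs (.ite x p q) s (n + 1) s'
  | ite_false {x : ℕ} {p q : Prog} {s s' : State} {n : ℕ} (hx : s.var x = 0) (h : Runs q s n s') :
      Runs (.ite x p q) s (n + 1) s'
  | loop_stop {x : ℕ} {p : Prog} {s : State} (hx : s.var x = 0) : Runs (.loop x p) s 1 s
  | loop_next {x : ℕ} {p : Prog} {s s' s'' : State} {n n' : ℕ} (hx : s.var x ≠ 0)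
      (h : Runs p s n s') (h' : Runs (.loop x p) s' n' s'') : Runs (.loop x p) s (n + n' + 1) s''

/-- The initial state on the input `(G, k)`: the variables `0`, `1`, `2` hold `|A|`, `|B|`, `k`, the
array `0` holds the biadjacency matrix of `G` row by row, and everything else is `0`. -/
def State.input (G : BipGraph) (k : ℕ) : State where
  var x := if x = 0 then G.numA else if x = 1 then G.numB else if x = 2 then k else 0
  arr t i := if ∃ (a : Fin G.numA) (b : Fin G.numB),
    t = 0 ∧ i = a.val * G.numB + b.val ∧ G.adj a b = true then 1 else 0

/-- In the state `s` the output is the instance `(G, k)`, in the format of the input; other memory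
cells are ignored. -/
def State.IsOutput (s : State) (G : BipGraph) (k : ℕ) : Prop :=
  s.var 0 = G.numA ∧ s.var 1 = G.numB ∧ s.var 2 = k ∧
    ∀ (a : Fin G.numA) (b : Fin G.numB),
      s.arr 0 (a.val * G.numB + b.val) = if G.adj a b = true then 1 else 0

end RAM

/-! ### Kernels and fixed-parameter tractability

`Q G k` is a problem about bipartite graphs `G` with a positive integer `k` as the parameter. -/

/-- `Q` has a kernel with at most `g k` vertices: some program maps every instance `(G, k)`, in time
polynomial in `|V(G)| + k`, to an equivalent instance `(G', k)` such that `G'` has at most `g k`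
vertices. -/
def HasKernelWithVertices (Q : BipGraph → ℕ → Prop) (g : ℕ → ℕ) : Prop :=
  ∃ (P : RAM.Prog) (c : ℕ), ∀ (G : BipGraph) (k : ℕ), 0 < k →
    ∃ (n : ℕ) (s : RAM.State) (G' : BipGraph),
      RAM.Runs P (RAM.State.input G k) n s ∧ n ≤ c * (G.order + k) ^ c ∧
      s.IsOutput G' k ∧ (Q G' k ↔ Q G k) ∧ G'.order ≤ g k

/-- `Q` is fixed-parameter tractable: some program decides every instance `(G, k)` in time
`f k * (|V(G)| + k) ^ c`, where `f` is computable and `c` is constant. The answer is found in the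
variable `0`. -/
def IsFixedParameterTractable (Q : BipGraph → ℕ → Prop) : Prop :=
  ∃ (P : RAM.Prog) (f : ℕ → ℕ) (c : ℕ), Computable f ∧ ∀ (G : BipGraph) (k : ℕ), 0 < k →
    ∃ (n : ℕ) (s : RAM.State),
      RAM.Runs P (RAM.State.input G k) n s ∧ n ≤ f k * (G.order + k) ^ c ∧
      (Q G k → s.var 0 = 1) ∧ (¬ Q G k → s.var 0 = 0)

/-! A solution can be recorded without its editing sequence. Every `a` gets one block `f a`, and
every `b` gets the nonempty set `S b` of the blocks in which its copies end up. The price at `b` is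
`(S b).card - 1` splits, plus one edge edition for each `a` whose adjacency to `b` disagrees with `f
a ∈ S b`. Undoing an operation raises the total price by at most one, and a positive price can
always be lowered by a suitable operation; hence `bceovs_iff_solvable`.

The kernel discards the biclique components and keeps at most `k + 1` vertices of each twin class. A
solution of cost at most `k` has at most `k` vertices of `A` with a mismatch and at most `k`
vertices of `B` with positive cost. So a discarded twin has a kept twin that the solution leaves
alone, and it can copy the blocks of that twin for free (`Solvable.of_keep`). Conversely, the
vertices touched by a solution meet at most `3 * k` blocks. Untouched vertices on one side of a
block are twins, and away from these blocks there are only biclique components, so a yes-instance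
keeps at most `14 * k ^ 2` vertices (`Solvable.card_keep_le`). A larger reduced graph is replaced by
a small no-instance. For `k ≥ 2` the bound `7 * k ^ 5` follows; for `k = 1` the reduced instance has
bounded size and is solved outright.

On the machine side, the reduction and the search are written as arithmetic expressions with bounded
sums, and one compiler theorem, `exec_compile`, gives correctness and a polynomial time bound for
all of them. Fixed-parameter tractability follows by kernelizing and then trying all solutions,
coded as the bits of a natural number. -/

/-! ### Editing sequences versus assignments of blocks -/

/-- The cost of a vertex of `B` with neighborhood `N` whose copies lie in the blocks `s`, if `a`
lies in the block `f a`. -/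
def blockCost {m : ℕ} (f : Fin m → ℕ) (s : Finset ℕ) (N : Fin m → Bool) : ℕ :=
  (s.card - 1) + (Finset.univ.filter fun a => ¬(N a = true ↔ f a ∈ s)).card

/-- The graph with the adjacency `adj` has a solution with cost at most `k`. -/
def Solvable {m n : ℕ} (adj : Fin m → Fin n → Bool) (k : ℕ) : Prop :=
  ∃ (f : Fin m → ℕ) (S : Fin n → Finset ℕ), (∀ b, (S b).Nonempty) ∧
    ∑ b, blockCost f (S b) (fun a => adj a b) ≤ k

theorem Solvable.mono {m n : ℕ} {adj : Fin m → Fin n → Bool} {k l : ℕ} (h : Solvable adj k)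
    (hkl : k ≤ l) : Solvable adj l := by
  obtain ⟨f, S, hS, hk⟩ := h
  exact ⟨f, S, hS, hk.trans hkl⟩

theorem blockCost_eq_zero {m : ℕ} {f : Fin m → ℕ} {s : Finset ℕ} {N : Fin m → Bool} :
    blockCost f s N = 0 ↔ s.card ≤ 1 ∧ ∀ a, N a = true ↔ f a ∈ s := by
  simp only [blockCost, Nat.add_eq_zero_iff, Finset.card_eq_zero, Finset.filter_eq_empty_iff,
    Finset.mem_univ, forall_true_left, not_not]
  refine and_congr (by omega) Iff.rfl

theorem sum_le_sum_add_one {n : ℕ} {c c' : Fin n → ℕ} (b : Fin n) (hb : c b ≤ c' b + 1)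
    (h : ∀ x, x ≠ b → c x ≤ c' x) : ∑ x, c x ≤ ∑ x, c' x + 1 := by
  rw [← Finset.add_sum_erase _ c (Finset.mem_univ b), ← Finset.add_sum_erase _ c' (Finset.mem_univ b)]
  have := Finset.sum_le_sum (s := Finset.univ.erase b) (f := c) (g := c')
    fun x hx => h x (Finset.ne_of_mem_erase hx)
  omega

theorem blockCost_le_add_one {m : ℕ} (f : Fin m → ℕ) (s : Finset ℕ) {N N' : Fin m → Bool}
    (a : Fin m) (h : ∀ x, x ≠ a → N x = N' x) : blockCost f s N ≤ blockCost f s N' + 1 := by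
  have : (Finset.univ.filter fun a => ¬(N a = true ↔ f a ∈ s)) ⊆
      insert a (Finset.univ.filter fun a => ¬(N' a = true ↔ f a ∈ s)) := by
    intro x hx
    by_cases hxa : x = a
    · simp [hxa]
    · simpa [hxa, h x hxa] using hx
  have := (Finset.card_le_card this).trans (Finset.card_insert_le _ _)
  unfold blockCost
  omega

theorem Solvable.of_eqOn_compl {m n : ℕ} {adj adj' : Fin m → Fin n → Bool} {k : ℕ} (a : Fin m)
    (b : Fin n) (h : ∀ x y, ¬(x = a ∧ y = b) → adj x y = adj' x y) (h' : Solvable adj' k) :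
    Solvable adj (k + 1) := by
  obtain ⟨f, S, hS, hk⟩ := h'
  refine ⟨f, S, hS, (sum_le_sum_add_one b ?_ ?_).trans (Nat.add_le_add_right hk 1)⟩
  · exact blockCost_le_add_one f _ a fun x hx => h x b (by simp [hx])
  · intro y hy
    rw [funext fun x => h x y (by simp [hy])]

/-- This undoes a split. A mismatch of the union is a mismatch of one of the copies, and since both
sets are nonempty, `(s ∪ t).card - 1` exceeds `(s.card - 1) + (t.card - 1)` by at most one. -/
theorem blockCost_union {m : ℕ} (f : Fin m → ℕ) {s t : Finset ℕ} {N P Q : Fin m → Bool}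
    (hs : s.Nonempty) (ht : t.Nonempty) (h : ∀ a, N a = true ↔ P a = true ∨ Q a = true) :
    blockCost f (s ∪ t) N ≤ blockCost f s P + blockCost f t Q + 1 := by
  have h1 := Finset.card_union_le s t
  have h2 := hs.card_pos
  have h3 := ht.card_pos
  have h4 : (Finset.univ.filter fun a => ¬(N a = true ↔ f a ∈ s ∪ t)) ⊆
      (Finset.univ.filter fun a => ¬(P a = true ↔ f a ∈ s)) ∪
      (Finset.univ.filter fun a => ¬(Q a = true ↔ f a ∈ t)) := by
    intro a
    have := h a
    simp only [Finset.mem_filter, Finset.mem_union, Finset.mem_univ, true_and]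
    tauto
  have h5 := (Finset.card_le_card h4).trans (Finset.card_union_le _ _)
  unfold blockCost
  omega

theorem Solvable.of_split {m n : ℕ} {adj : Fin m → Fin n → Bool} {k : ℕ} (b : Fin n)
    (P Q : Fin m → Bool) (h : ∀ a, adj a b = true ↔ P a = true ∨ Q a = true)
    (h' : Solvable (n := n + 1) (fun x => Fin.snoc (α := fun _ => Bool)
      (fun y : Fin n => if y = b then P x else adj x y) (Q x)) k) :
    Solvable adj (k + 1) := by
  obtain ⟨f, S, hS, hk⟩ := h'
  rw [Fin.sum_univ_castSucc] at hk
  simp only [Fin.snoc_castSucc, Fin.snoc_last] at hk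
  refine ⟨f, fun x => if x = b then S (Fin.castSucc b) ∪ S (Fin.last _) else S (Fin.castSucc x),
    ?_, ?_⟩
  · intro x
    dsimp only
    split_ifs
    · exact (hS _).mono Finset.subset_union_left
    · exact hS _
  -- The cost of the new copy is charged to `b`, so that both sums range over `Fin n` and differ
  -- only at `b`.
  · set c' : Fin n → ℕ := fun y =>
      blockCost f (S y.castSucc) (fun a => if y = b then P a else adj a y) +
        if y = b then blockCost f (S (Fin.last n)) Q else 0 with hc'
    have : ∑ x, c' x ≤ k := by
      rw [hc', Finset.sum_add_distrib]
      simpa using hk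
    refine (sum_le_sum_add_one (c' := c') b ?_ ?_).trans (Nat.add_le_add_right this 1)
    · simp only [hc', if_true]
      exact blockCost_union f (hS _) (hS _) h
    · intro x hx
      simp [hc', hx]

namespace BipGraph

theorem Edit.solvable {G H : BipGraph} {k : ℕ} (e : Edit G H) (h : Solvable H.adj k) :
    Solvable G.adj (k + 1) := by
  cases e with
  | add a b _ => exact h.of_eqOn_compl a b fun x y hxy => by simp [addEdge, hxy]
  | delete a b _ => exact h.of_eqOn_compl a b fun x y hxy => by simp [deleteEdge, hxy]
  | split b P Q hPQ => exact h.of_split b P Q hPQ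

theorem EditSeq.solvable {l : ℕ} {G H : BipGraph} (h : EditSeq l G H)
    (hH : H.IsDisjointUnionOfBicliques) : Solvable G.adj l := by
  induction h with
  | nil G =>
    obtain ⟨f, g, hfg⟩ := hH
    exact ⟨f, fun b => {g b}, by simp, by simp [blockCost, hfg]⟩
  | cons h _ ih => exact h.solvable (ih hH)

end BipGraph

theorem sum_blockCost_lt {m n : ℕ} {adj adj' : Fin m → Fin n → Bool} {f : Fin m → ℕ}
    {S : Fin n → Finset ℕ} {a : Fin m} {b : Fin n} (hab : ¬(adj a b = true ↔ f a ∈ S b))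
    (h1 : ∀ x y, ¬(x = a ∧ y = b) → adj' x y = adj x y) (h2 : adj' a b = !adj a b) :
    ∑ y, blockCost f (S y) (fun x => adj' x y) < ∑ y, blockCost f (S y) (fun x => adj x y) := by
  have hab' : adj' a b = true ↔ f a ∈ S b := by
    cases hh : adj a b <;> simp_all
  refine Finset.sum_lt_sum (fun y _ => ?_) ⟨b, Finset.mem_univ _, ?_⟩
  · refine Nat.add_le_add_left (Finset.card_le_card ?_) _
    intro x
    by_cases hxy : x = a ∧ y = b
    · obtain ⟨rfl, rfl⟩ := hxy
      simp [hab, hab']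
    · simp [h1 x y hxy]
  · refine Nat.add_lt_add_left (Finset.card_lt_card ?_) _
    rw [Finset.ssubset_iff_of_subset]
    · exact ⟨a, by simp [hab], by simp [hab']⟩
    · intro x
      by_cases hxy : x = a
      · subst hxy
        simp [hab, hab']
      · simp [h1 x b (by simp [hxy])]

/-- Without mismatches, splitting off the block `i` produces copies that fit `{i}` and `(S b).erase
i` exactly. Their costs are `0` and `(S b).card - 2`, where `b` had `(S b).card - 1`. -/
theorem sum_blockCost_split_le {m n k : ℕ} {adj : Fin m → Fin n → Bool} {f : Fin m → ℕ}
    {S : Fin n → Finset ℕ} (hm : ∀ a b, adj a b = true ↔ f a ∈ S b) {b : Fin n}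
    (hb : 1 < (S b).card) {i : ℕ} (hi : i ∈ S b)
    (h : ∑ y, blockCost f (S y) (fun x => adj x y) ≤ k + 1) :
    ∑ y : Fin (n + 1), blockCost f (Fin.snoc (α := fun _ => Finset ℕ)
        (fun y : Fin n => if y = b then {i} else S y) ((S b).erase i) y)
      (fun x => Fin.snoc (α := fun _ => Bool)
        (fun y : Fin n => if y = b then decide (f x = i) else adj x y)
        (decide (f x ∈ (S b).erase i)) y) ≤ k := by
  have hcard := Finset.card_erase_of_mem hi
  rw [Fin.sum_univ_castSucc]
  simp only [Fin.snoc_castSucc, Fin.snoc_last]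
  have h1 : ∀ y : Fin n, blockCost f (if y = b then {i} else S y)
      (fun x => if y = b then decide (f x = i) else adj x y) =
      if y = b then 0 else (S y).card - 1 := by
    intro y
    by_cases hy : y = b <;> simp [blockCost, hy, hm]
  have h2 : blockCost f ((S b).erase i) (fun x => decide (f x ∈ (S b).erase i)) =
      (S b).card - 2 := by
    simp only [blockCost, hcard, decide_eq_true_eq, not_true_eq_false, Finset.filter_false,
      Finset.card_empty]
    omega
  have h3 : ∀ y, blockCost f (S y) (fun x => adj x y) = (S y).card - 1 := by
    intro y
    simp [blockCost, hm]
  simp only [h1, h2, h3] at h ⊢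
  rw [← Finset.add_sum_erase _ _ (Finset.mem_univ b)] at h ⊢
  have h4 := Finset.sum_congr (s₁ := Finset.univ.erase b) rfl
    (f := fun y => if y = b then 0 else (S y).card - 1)
    (g := fun y => (S y).card - 1) (fun y hy => by simp [Finset.ne_of_mem_erase hy])
  rw [h4]
  simp only [if_true]
  omega

/-- Mismatches are repaired one at a time; once there are none, sets with several blocks are split.
Each operation saves one unit. The graph is generalized in the induction because a split enlarges
`B`. -/
theorem Solvable.exists_editSeq {k : ℕ} : ∀ {m n : ℕ} {adj : Fin m → Fin n → Bool},
    Solvable adj k → ∃ l H, l ≤ k ∧ BipGraph.EditSeq l ⟨m, n, adj⟩ H ∧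
      H.IsDisjointUnionOfBicliques := by
  induction k with
  | zero =>
    rintro m n adj ⟨f, S, hS, h⟩
    refine ⟨0, _, le_rfl, .nil _, f, fun b => (hS b).choose, fun a b => ?_⟩
    change Fin n at b
    change Fin m at a
    have h0 : blockCost f (S b) (fun a => adj a b) = 0 :=
      Finset.sum_eq_zero_iff.1 (Nat.le_zero.1 h) b (Finset.mem_univ b)
    rw [blockCost_eq_zero] at h0
    have hc := (hS b).choose_spec
    refine (h0.2 a).trans ⟨fun h => Finset.card_le_one.1 h0.1 _ h _ hc, fun h => ?_⟩
    rw [h]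
    exact hc
  | succ k ih =>
    rintro m n adj ⟨f, S, hS, h⟩
    by_cases hm : ∃ a b, ¬(adj a b = true ↔ f a ∈ S b)
    · obtain ⟨a, b, hab⟩ := hm
      cases hh : adj a b with
      | false =>
        obtain ⟨l, H, hl, hs, hH⟩ := ih
          (adj := fun x y => if x = a ∧ y = b then true else adj x y) ⟨f, S, hS, by
            have := sum_blockCost_lt (adj' := fun x y => if x = a ∧ y = b then true else adj x y)
              hab (fun x y hxy => by simp [hxy]) (by simp [hh])
            exact Nat.le_of_lt_succ (this.trans_le h)⟩
        exact ⟨l + 1, H, by omega, .cons (.add ⟨m, n, adj⟩ a b hh) hs, hH⟩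
      | true =>
        obtain ⟨l, H, hl, hs, hH⟩ := ih
          (adj := fun x y => if x = a ∧ y = b then false else adj x y) ⟨f, S, hS, by
            have := sum_blockCost_lt (adj' := fun x y => if x = a ∧ y = b then false else adj x y)
              hab (fun x y hxy => by simp [hxy]) (by simp [hh])
            exact Nat.le_of_lt_succ (this.trans_le h)⟩
        exact ⟨l + 1, H, by omega, .cons (.delete ⟨m, n, adj⟩ a b hh) hs, hH⟩
    · push Not at hm
      by_cases hc : ∃ b, 1 < (S b).card
      · obtain ⟨b, hb⟩ := hc
        obtain ⟨i, hi⟩ := hS b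
        obtain ⟨l, H, hl, hs, hH⟩ := ih ⟨f, _, fun y => by
            refine Fin.lastCases ?_ (fun y => ?_) y
            · have hcard := Finset.card_erase_of_mem hi
              simp only [Fin.snoc_last]
              exact Finset.card_pos.1 (by omega)
            · simp only [Fin.snoc_castSucc]
              split_ifs
              · simp
              · exact hS y, sum_blockCost_split_le hm hb hi h⟩
        refine ⟨l + 1, H, by omega, .cons (.split ⟨m, n, adj⟩ b _ _ fun a => ?_) hs, hH⟩
        simp only [hm, decide_eq_true_eq, Finset.mem_erase]
        by_cases f a = i <;> simp_all
      · push Not at hc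
        obtain ⟨l, H, hl, hs⟩ := ih (adj := adj) ⟨f, S, hS, by
          have : ∀ b, blockCost f (S b) (fun a => adj a b) = 0 := fun b =>
            blockCost_eq_zero.2 ⟨hc b, fun a => hm a b⟩
          simp [this]⟩
        exact ⟨l, H, by omega, hs⟩

theorem bceovs_iff_solvable (G : BipGraph) (k : ℕ) : BCEOVS G k ↔ Solvable G.adj k := by
  constructor
  · rintro ⟨l, H, hl, hs, hH⟩
    exact (hs.solvable hH).mono hl
  · exact fun h => h.exists_editSeq

/-! ### The reduction rules: biclique components and large twin classes -/

section Reduction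

variable {m n : ℕ} (adj : Fin m → Fin n → Bool) (k : ℕ)

/-- `a` and `a'` have the same neighborhood. -/
def TwinA (a a' : Fin m) : Prop := adj a = adj a'

/-- `b` and `b'` have the same neighborhood. -/
def TwinB (b b' : Fin n) : Prop := ∀ a, adj a b = adj a b'

/-- The component of `a` is a biclique. -/
def BicliqueA (a : Fin m) : Prop := ∀ b a', adj a b = true → adj a' b = true → TwinA adj a' a

/-- The component of `b` is a biclique. -/
def BicliqueB (b : Fin n) : Prop := ∀ a, adj a b = true → BicliqueA adj a

instance (a a' : Fin m) : Decidable (TwinA adj a a') := by unfold TwinA; infer_instance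
instance (b b' : Fin n) : Decidable (TwinB adj b b') := by unfold TwinB; infer_instance
instance : DecidablePred (BicliqueA adj) := fun a => by unfold BicliqueA; infer_instance
instance : DecidablePred (BicliqueB adj) := fun a => by unfold BicliqueB; infer_instance

/-- `a` is not in a biclique component and has at most `k` earlier twins. -/
def KeepA (a : Fin m) : Prop :=
  ¬BicliqueA adj a ∧ (Finset.univ.filter fun a' => a' < a ∧ TwinA adj a' a).card ≤ k

/-- `b` is not in a biclique component and has at most `k` earlier twins. -/
def KeepB (b : Fin n) : Prop :=
  ¬BicliqueB adj b ∧ (Finset.univ.filter fun b' => b' < b ∧ TwinB adj b' b).card ≤ k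

instance : DecidablePred (KeepA adj k) := fun a => by unfold KeepA; infer_instance
instance : DecidablePred (KeepB adj k) := fun a => by unfold KeepB; infer_instance

variable {adj k}

theorem BicliqueA.of_twin {a a' : Fin m} (h : BicliqueA adj a) (h' : TwinA adj a' a) :
    BicliqueA adj a' := fun b a'' h1 h2 => (h b a'' (by rw [← h']; exact h1) h2).trans h'.symm

theorem BicliqueB.of_twin {b b' : Fin n} (h : BicliqueB adj b) (h' : TwinB adj b' b) :
    BicliqueB adj b' := fun a h1 => h a (by rw [← h']; exact h1)

theorem BicliqueA.bicliqueB {a : Fin m} {b : Fin n} (h : BicliqueA adj a) (hab : adj a b = true) :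
    BicliqueB adj b := fun a' h' => h.of_twin (h b a' hab h')

/-- Otherwise some element has more than `k` predecessors in `t`. All predecessors of the least such
element have at most `k` predecessors themselves, so by assumption there are at most `k` of them. -/
theorem lt_card_filter_card_filter_lt_le {n k : ℕ} (t : Finset (Fin n)) (h : k < t.card) :
    k < (t.filter fun x => (t.filter fun y => y < x).card ≤ k).card := by
  by_contra! hk
  obtain ⟨x, hx⟩ : (t.filter fun x => ¬(t.filter fun y => y < x).card ≤ k).Nonempty := by
    rw [← Finset.card_pos]
    have := t.card_filter_add_card_filter_not (fun x => (t.filter fun y => y < x).card ≤ k)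
    omega
  obtain ⟨x, hx, hmin⟩ := Finset.exists_min_image _ id ⟨x, hx⟩
  rw [Finset.mem_filter] at hx
  refine hx.2 ((Finset.card_le_card ?_).trans hk)
  intro y hy
  rw [Finset.mem_filter] at hy ⊢
  refine ⟨hy.1, ?_⟩
  by_contra hyk
  exact absurd (hmin y (Finset.mem_filter.2 ⟨hy.1, hyk⟩)) (not_le.2 hy.2)

/-- The twin class of a discarded vertex retains more than `k` members, so one of them avoids `u`.
Here `u` will be the set of vertices that a solution of the reduced graph disturbs. -/
theorem exists_keep_twinA {a : Fin m} (ha : ¬BicliqueA adj a) (hk : ¬KeepA adj k a)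
    (u : Finset (Fin m)) (hu : u.card ≤ k) : ∃ a', KeepA adj k a' ∧ TwinA adj a' a ∧ a' ∉ u := by
  set t := Finset.univ.filter fun a' => TwinA adj a' a with ht
  have h1 : k < t.card := by
    rw [KeepA, not_and, not_le] at hk
    refine (hk ha).trans_le (Finset.card_le_card fun x => ?_)
    simp +contextual [ht]
  obtain ⟨x, hx, hxu⟩ := Finset.exists_mem_notMem_of_card_lt_card
    (hu.trans_lt (lt_card_filter_card_filter_lt_le t h1))
  simp only [ht, Finset.mem_filter, Finset.mem_univ, true_and, Finset.filter_filter] at hx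
  refine ⟨x, ⟨fun h => ha (h.of_twin hx.1.symm), le_trans (Finset.card_le_card ?_) hx.2⟩, hx.1, hxu⟩
  intro y
  simp only [Finset.mem_filter, Finset.mem_univ, true_and]
  exact fun h => ⟨h.2.trans hx.1, h.1⟩

theorem exists_keep_twinB {b : Fin n} (hb : ¬BicliqueB adj b) (hk : ¬KeepB adj k b)
    (u : Finset (Fin n)) (hu : u.card ≤ k) : ∃ b', KeepB adj k b' ∧ TwinB adj b' b ∧ b' ∉ u := by
  set t := Finset.univ.filter fun b' => TwinB adj b' b with ht
  have h1 : k < t.card := by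
    rw [KeepB, not_and, not_le] at hk
    refine (hk hb).trans_le (Finset.card_le_card fun x => ?_)
    simp +contextual [ht]
  obtain ⟨x, hx, hxu⟩ := Finset.exists_mem_notMem_of_card_lt_card
    (hu.trans_lt (lt_card_filter_card_filter_lt_le t h1))
  simp only [ht, Finset.mem_filter, Finset.mem_univ, true_and, Finset.filter_filter] at hx
  refine ⟨x, ⟨fun h => hb (h.of_twin fun a => (hx.1 a).symm),
    le_trans (Finset.card_le_card ?_) hx.2⟩, hx.1, hxu⟩
  intro y
  simp only [Finset.mem_filter, Finset.mem_univ, true_and]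
  exact fun h => ⟨fun a => (h.2 a).trans (hx.1 a), h.1⟩

theorem Solvable.comap {m' n' : ℕ} {ι : Fin m' → Fin m} {κ : Fin n' → Fin n}
    (hι : Function.Injective ι) (hκ : Function.Injective κ) (h : Solvable adj k) :
    Solvable (fun i j => adj (ι i) (κ j)) k := by
  obtain ⟨f, S, hS, hk⟩ := h
  refine ⟨f ∘ ι, S ∘ κ, fun j => hS _, le_trans ?_ hk⟩
  calc _ ≤ ∑ j, blockCost f (S (κ j)) (fun a => adj a (κ j)) := by
        refine Finset.sum_le_sum fun j _ => Nat.add_le_add_left ?_ _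
        refine Finset.card_le_card_of_injOn ι ?_ hι.injOn
        intro i hi
        simpa using hi
    _ = ∑ b ∈ Finset.univ.map ⟨κ, hκ⟩, blockCost f (S b) (fun a => adj a b) := by
        rw [Finset.sum_map]; rfl
    _ ≤ _ := Finset.sum_le_sum_of_subset (Finset.subset_univ _)

theorem card_filter_blockCost_le {f : Fin m → ℕ} {S : Fin n → Finset ℕ}
    (hk : ∑ b, blockCost f (S b) (fun a => adj a b) ≤ k) :
    (Finset.univ.filter fun b => blockCost f (S b) (fun a => adj a b) ≠ 0).card ≤ k := by
  refine le_trans ?_ hk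
  rw [Finset.card_filter]
  exact Finset.sum_le_sum fun b _ => by split_ifs <;> omega

theorem card_filter_mismatch_le {f : Fin m → ℕ} {S : Fin n → Finset ℕ}
    (hk : ∑ b, blockCost f (S b) (fun a => adj a b) ≤ k) :
    (Finset.univ.filter fun a => ∃ b, ¬(adj a b = true ↔ f a ∈ S b)).card ≤ k := by
  refine le_trans ?_ hk
  have : (Finset.univ.filter fun a => ∃ b, ¬(adj a b = true ↔ f a ∈ S b)) ⊆
      Finset.univ.biUnion fun b => Finset.univ.filter fun a => ¬(adj a b = true ↔ f a ∈ S b) := by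
    intro a
    simp
  refine (Finset.card_le_card this).trans (Finset.card_biUnion_le.trans ?_)
  exact Finset.sum_le_sum fun b _ => Nat.le_add_left _ _

/-- Outside the biclique components, every vertex copies the blocks of a representative: itself, or
a twin that the given solution leaves undisturbed. Biclique components receive fresh blocks and cost
nothing. -/
theorem Solvable.of_keep {m' n' : ℕ} {ι : Fin m' → Fin m} {κ : Fin n' → Fin n}
    (hι : Function.Injective ι) (hκ : Function.Injective κ)
    (hι' : ∀ a, KeepA adj k a → ∃ i, ι i = a) (hκ' : ∀ b, KeepB adj k b → ∃ j, κ j = b)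
    (h : Solvable (fun i j => adj (ι i) (κ j)) k) : Solvable adj k := by
  obtain ⟨f, S, hS, hk⟩ := h
  have hA : ∀ a, ¬BicliqueA adj a → ∃ i, TwinA adj (ι i) a ∧
      (ι i = a ∨ ∀ j, adj (ι i) (κ j) = true ↔ f i ∈ S j) := by
    intro a ha
    by_cases hka : KeepA adj k a
    · obtain ⟨i, rfl⟩ := hι' a hka
      exact ⟨i, rfl, .inl rfl⟩
    · obtain ⟨a', h1, h2, h3⟩ := exists_keep_twinA ha hka _
        ((Finset.card_map ⟨ι, hι⟩).trans_le (card_filter_mismatch_le hk))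
      obtain ⟨i, rfl⟩ := hι' a' h1
      refine ⟨i, h2, .inr fun j => ?_⟩
      by_contra hij
      exact h3 (Finset.mem_map.2 ⟨i, Finset.mem_filter.2 ⟨Finset.mem_univ _, j, hij⟩, rfl⟩)
  have hB : ∀ b, ¬BicliqueB adj b → ∃ j, TwinB adj (κ j) b ∧
      (κ j = b ∨ blockCost f (S j) (fun i => adj (ι i) (κ j)) = 0) := by
    intro b hb
    by_cases hkb : KeepB adj k b
    · obtain ⟨j, rfl⟩ := hκ' b hkb
      exact ⟨j, fun _ => rfl, .inl rfl⟩
    · obtain ⟨b', h1, h2, h3⟩ := exists_keep_twinB hb hkb _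
        ((Finset.card_map ⟨κ, hκ⟩).trans_le (card_filter_blockCost_le hk))
      obtain ⟨j, rfl⟩ := hκ' b' h1
      refine ⟨j, h2, .inr ?_⟩
      by_contra hj
      exact h3 (Finset.mem_map.2 ⟨j, Finset.mem_filter.2 ⟨Finset.mem_univ _, hj⟩, rfl⟩)
  choose iA hiA using hA
  choose jB hjB using hB
  -- Labels below `M` belong to the old solution, `M` itself is the block of the isolated vertices
  -- of `B`, and a biclique component gets the label `M + 1 +` the code of the neighborhood shared
  -- by its vertices in `A`.
  obtain ⟨M, hM⟩ : ∃ M, ∀ x ∈ Finset.univ.image f ∪ Finset.univ.biUnion S, x < M :=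
    ⟨_, fun x hx => Nat.lt_succ_of_le (Finset.le_sup (f := id) hx)⟩
  have hfM : ∀ i, f i < M := fun i => hM _ (by simp)
  have hSM : ∀ j, ∀ x ∈ S j, x < M := fun j x hx =>
    hM _ (Finset.mem_union_right _ (Finset.mem_biUnion.2 ⟨j, Finset.mem_univ _, hx⟩))
  let code : (Fin n → Bool) → ℕ := fun N => Fintype.equivFin _ N
  have hcode : Function.Injective code :=
    Fin.val_injective.comp (Fintype.equivFin (Fin n → Bool)).injective
  let g : Fin m → ℕ := fun a => if h : BicliqueA adj a then M + 1 + code (adj a) else f (iA a h)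
  let T : Fin n → Finset ℕ := fun b => if h : BicliqueB adj b then
    (if h' : ∃ a, adj a b = true then {M + 1 + code (adj h'.choose)} else {M}) else S (jB b h)
  have hg : ∀ a (h : ¬BicliqueA adj a), g a = f (iA a h) := fun a h => dif_neg h
  have hT : ∀ b (h : ¬BicliqueB adj b), T b = S (jB b h) := fun b h => dif_neg h
  have hAB : ∀ a b, BicliqueA adj a → ¬BicliqueB adj b → (adj a b = true ↔ g a ∈ T b) := by
    intro a b ha hb
    rw [hT b hb, show g a = M + 1 + code (adj a) from dif_pos ha]
    refine iff_of_false (fun h => hb (ha.bicliqueB h)) (fun h => ?_)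
    have := hSM _ _ h
    omega
  have hzero : ∀ b, BicliqueB adj b → blockCost g (T b) (fun a => adj a b) = 0 := by
    intro b hb
    rw [blockCost_eq_zero]
    by_cases h' : ∃ a, adj a b = true
    · have hTb : T b = {M + 1 + code (adj h'.choose)} := by
        simp only [T, dif_pos hb, dif_pos h']
      have hc := h'.choose_spec
      refine ⟨by simp [hTb], fun a => ?_⟩
      rw [hTb, Finset.mem_singleton]
      by_cases ha : BicliqueA adj a
      · rw [show g a = M + 1 + code (adj a) from dif_pos ha]
        refine ⟨fun h => ?_, fun h => ?_⟩
        · rw [show adj h'.choose = adj a from ha b _ h hc]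
        · have : adj a = adj h'.choose := hcode (by omega)
          rw [this, hc]
      · refine iff_of_false (fun h => ha (hb a h)) ?_
        rw [hg a ha]
        have := hfM (iA a ha)
        omega
    · have hTb : T b = {M} := by
        simp only [T, dif_pos hb, dif_neg h']
      refine ⟨by simp [hTb], fun a => iff_of_false (fun h => h' ⟨a, h⟩) ?_⟩
      rw [hTb, Finset.mem_singleton]
      by_cases ha : BicliqueA adj a
      · rw [show g a = M + 1 + code (adj a) from dif_pos ha]
        omega
      · rw [hg a ha]
        exact (hfM _).ne
  have hle : ∀ b (hb : ¬BicliqueB adj b), blockCost g (T b) (fun a => adj a b) ≤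
      blockCost f (S (jB b hb)) (fun i => adj (ι i) (κ (jB b hb))) := by
    intro b hb
    unfold blockCost
    rw [hT b hb]
    refine Nat.add_le_add_left ?_ _
    rw [← Finset.card_map ⟨ι, hι⟩]
    refine Finset.card_le_card fun a ha => ?_
    simp only [Finset.mem_filter, Finset.mem_univ, true_and] at ha
    have hna : ¬BicliqueA adj a := fun h => ha (by simpa only [hT b hb] using hAB a b h hb)
    obtain ⟨h1, h2⟩ := hiA a hna
    obtain ⟨h3, h4⟩ := hjB b hb
    rw [← h3, show adj a = adj (ι (iA a hna)) from h1.symm, hg a hna] at ha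
    refine Finset.mem_map.2 ⟨iA a hna, Finset.mem_filter.2 ⟨Finset.mem_univ _, ha⟩, ?_⟩
    -- A representative with a mismatch is not an undisturbed twin, so it is `a` itself. Hence the
    -- mismatches at `b` inject into those at its representative.
    exact h2.resolve_right fun h => ha (h _)
  refine ⟨g, T, fun b => ?_, ?_⟩
  · simp only [T]
    split_ifs
    · simp
    · simp
    · exact hS _
  · refine le_trans ?_ hk
    calc _ ≤ ∑ b ∈ Finset.univ.map ⟨κ, hκ⟩, blockCost g (T b) (fun a => adj a b) := by
          -- A vertex outside the range of `κ` is not its own representative, so it either copies a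
          -- vertex of cost zero or lies in a biclique component.
          refine (Finset.sum_subset (Finset.subset_univ _) fun b _ hb => ?_).ge
          by_cases hbb : BicliqueB adj b
          · exact hzero b hbb
          · refine Nat.le_zero.1 ((hle b hbb).trans ?_)
            refine ((hjB b hbb).2.resolve_left fun h => hb ?_).le
            exact Finset.mem_map.2 ⟨_, Finset.mem_univ _, h⟩
      _ = ∑ j, blockCost g (T (κ j)) (fun a => adj a (κ j)) := by
          rw [Finset.sum_map]; rfl
      _ ≤ _ := by
          refine Finset.sum_le_sum fun j _ => ?_
          by_cases hbb : BicliqueB adj (κ j)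
          · exact (hzero _ hbb).trans_le (Nat.zero_le _)
          · refine (hle _ hbb).trans ?_
            rcases (hjB _ hbb).2 with h | h
            · rw [hκ h]
            · exact h.trans_le (Nat.zero_le _)

/-- The largest element of `s` has all the others as predecessors. -/
theorem card_le_of_twins {s : Finset (Fin m)}
    (h : ∀ a ∈ s, (s.filter fun a' => a' < a).card ≤ k) : s.card ≤ k + 1 := by
  rcases s.eq_empty_or_nonempty with rfl | hs
  · simp
  · have h1 := h _ (s.max'_mem hs)
    have h2 : s.erase (s.max' hs) ⊆ s.filter fun a' => a' < s.max' hs := fun x hx =>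
      Finset.mem_filter.2 ⟨Finset.mem_of_mem_erase hx, s.lt_max'_of_mem_erase_max' hs hx⟩
    have h3 := Finset.card_le_card h2
    rw [Finset.card_erase_of_mem (s.max'_mem hs)] at h3
    omega

/-- `affA` and `affB` are the vertices that the solution touches, and `I` is the set of blocks they
meet. Kept vertices are touched or lie in a block of `I`, and each block holds at most `k + 1`
untouched kept vertices per side, because these are twins. -/
theorem Solvable.card_keep_le (hk0 : 0 < k) (h : Solvable adj k) :
    (Finset.univ.filter (KeepA adj k)).card + (Finset.univ.filter (KeepB adj k)).card ≤
      14 * k ^ 2 := by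
  obtain ⟨f, S, hS, hk⟩ := h
  set affA := Finset.univ.filter fun a => ∃ b, ¬(adj a b = true ↔ f a ∈ S b) with haffA
  set affB := Finset.univ.filter fun b => blockCost f (S b) (fun a => adj a b) ≠ 0 with haffB
  have hcA : affA.card ≤ k := card_filter_mismatch_le hk
  have hcB : affB.card ≤ k := card_filter_blockCost_le hk
  set I := affA.image f ∪ affB.biUnion S with hI
  have hcI : I.card ≤ 3 * k := by
    have h1 := Finset.card_union_le (affA.image f) (affB.biUnion S)
    have h2 := Finset.card_image_le (s := affA) (f := f)
    -- On `affB` the cost is at least `1` and at least `(S b).card - 1`, so twice the cost bounds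
    -- `(S b).card`. Together with `affA` this yields `k + 2 * k` blocks.
    have h3 : (affB.biUnion S).card ≤ ∑ b ∈ affB, 2 * blockCost f (S b) (fun a => adj a b) := by
      refine Finset.card_biUnion_le.trans (Finset.sum_le_sum fun b hb => ?_)
      rw [haffB, Finset.mem_filter] at hb
      have h4 : (S b).card - 1 ≤ blockCost f (S b) (fun a => adj a b) := Nat.le_add_right _ _
      omega
    rw [← Finset.mul_sum] at h3
    have h4 : ∑ b ∈ affB, blockCost f (S b) (fun a => adj a b) ≤ k :=
      (Finset.sum_le_sum_of_subset (Finset.subset_univ _)).trans hk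
    rw [hI]
    omega
  have hnA : ∀ a, a ∉ affA → ∀ b, adj a b = true ↔ f a ∈ S b := by
    intro a ha b
    by_contra hab
    exact ha (Finset.mem_filter.2 ⟨Finset.mem_univ _, b, hab⟩)
  have hnB : ∀ b, b ∉ affB → ∃ i, S b = {i} ∧ ∀ a, adj a b = true ↔ f a = i := by
    intro b hb
    have h0 : blockCost f (S b) (fun a => adj a b) = 0 := by
      by_contra h
      exact hb (Finset.mem_filter.2 ⟨Finset.mem_univ _, h⟩)
    rw [blockCost_eq_zero] at h0
    obtain ⟨i, hi⟩ := Finset.card_eq_one.1 (le_antisymm h0.1 (hS b).card_pos)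
    exact ⟨i, hi, fun a => by simp [h0.2, hi]⟩
  -- If `f a ∉ I`, then every vertex of `A` in this block and every neighbor `b` of `a` is
  -- untouched. So `b` has a single block, all its neighbors lie in it, and untouched vertices of
  -- `A` with equal `f` have equal neighborhoods.
  have hAI : ∀ a, ¬BicliqueA adj a → f a ∈ I := by
    intro a ha
    by_contra hfa
    have hna : ∀ a', f a' = f a → a' ∉ affA := fun a' h h' =>
      hfa (Finset.mem_union_left _ (Finset.mem_image.2 ⟨a', h', h⟩))
    refine ha fun b a' h1 h2 => ?_
    have hb : b ∉ affB := fun hb => hfa (Finset.mem_union_right _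
      (Finset.mem_biUnion.2 ⟨b, hb, (hnA a (hna a rfl) b).1 h1⟩))
    obtain ⟨i, -, hi⟩ := hnB b hb
    have hff : f a' = f a := ((hi a').1 h2).trans ((hi a).1 h1).symm
    refine funext fun b' => Bool.eq_iff_iff.2 ?_
    rw [hnA a (hna a rfl), hnA a' (hna a' hff), hff]
  have hKA : (Finset.univ.filter (KeepA adj k)).card ≤ k + 3 * k * (k + 1) := by
    have hsub : Finset.univ.filter (KeepA adj k) ⊆ affA ∪ I.biUnion fun i =>
        Finset.univ.filter fun a => KeepA adj k a ∧ a ∉ affA ∧ f a = i := by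
      intro a ha
      rw [Finset.mem_filter] at ha
      by_cases h : a ∈ affA
      · exact Finset.mem_union_left _ h
      · exact Finset.mem_union_right _ (Finset.mem_biUnion.2
          ⟨f a, hAI a ha.2.1, Finset.mem_filter.2 ⟨Finset.mem_univ _, ha.2, h, rfl⟩⟩)
    refine (Finset.card_le_card hsub).trans ((Finset.card_union_le _ _).trans
      (Nat.add_le_add hcA ((Finset.card_biUnion_le_card_mul _ _ (k + 1) fun i _ => ?_).trans
        (Nat.mul_le_mul_right _ hcI))))
    refine card_le_of_twins fun a ha => ?_
    rw [Finset.mem_filter] at ha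
    refine le_trans (Finset.card_le_card fun a' ha' => ?_) ha.2.1.2
    simp only [Finset.mem_filter, Finset.mem_univ, true_and] at ha' ⊢
    refine ⟨ha'.2, funext fun b => Bool.eq_iff_iff.2 ?_⟩
    rw [hnA a ha.2.2.1, hnA a' ha'.1.2.1, ha.2.2.2, ha'.1.2.2]
  have hKB : (Finset.univ.filter (KeepB adj k)).card ≤ k + 3 * k * (k + 1) := by
    have hsub : Finset.univ.filter (KeepB adj k) ⊆ affB ∪ I.biUnion fun i =>
        Finset.univ.filter fun b => KeepB adj k b ∧ ∀ a, adj a b = true ↔ f a = i := by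
      intro b hb
      rw [Finset.mem_filter] at hb
      by_cases h : b ∈ affB
      · exact Finset.mem_union_left _ h
      · obtain ⟨i, -, hi⟩ := hnB b h
        have h1 := hb.2.1
        simp only [BicliqueB, not_forall] at h1
        obtain ⟨a, hab, ha⟩ := h1
        exact Finset.mem_union_right _ (Finset.mem_biUnion.2
          ⟨i, (hi a).1 hab ▸ hAI a ha, Finset.mem_filter.2 ⟨Finset.mem_univ _, hb.2, hi⟩⟩)
    refine (Finset.card_le_card hsub).trans ((Finset.card_union_le _ _).trans
      (Nat.add_le_add hcB ((Finset.card_biUnion_le_card_mul _ _ (k + 1) fun i _ => ?_).trans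
        (Nat.mul_le_mul_right _ hcI))))
    refine card_le_of_twins fun b hb => ?_
    rw [Finset.mem_filter] at hb
    refine le_trans (Finset.card_le_card fun b' hb' => ?_) hb.2.1.2
    simp only [Finset.mem_filter, Finset.mem_univ, true_and] at hb' ⊢
    refine ⟨hb'.2, fun a => Bool.eq_iff_iff.2 ?_⟩
    rw [hb.2.2, hb'.1.2]
  -- `2 * (k + 3 * k * (k + 1)) = 6 * k ^ 2 + 8 * k`, and `8 * k ≤ 8 * k ^ 2` because `k` is
  -- positive.
  nlinarith

end Reduction

/-! ### Trivial instances -/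

/-- A small graph without solution: `0 ∈ A` is adjacent to all `2 * k + 2` vertices of `B`, `1 ∈ A`
to the last `k + 1` of them. -/
def noInstance (k : ℕ) : BipGraph where
  numA := 2
  numB := 2 * k + 2
  adj i j := decide (i.val = 0 ∨ k < j.val)

/-- If both vertices of `A` share a block, each of the first `k + 1` vertices of `B` sees only one
of them and costs something. If they do not, each of the last `k + 1` vertices needs two blocks or
an edge edition. -/
theorem not_bceovs_noInstance (k : ℕ) : ¬BCEOVS (noInstance k) k := by
  rw [bceovs_iff_solvable]
  rintro ⟨f, S, hS, hk⟩
  have h1 := card_filter_blockCost_le hk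
  change Fin 2 → ℕ at f
  change Fin (2 * k + 2) → Finset ℕ at S
  have key : ∃ e : Fin (k + 1) → Fin (2 * k + 2), Function.Injective e ∧
      ∀ x, blockCost f (S (e x)) (fun a => (noInstance k).adj a (e x)) ≠ 0 := by
    by_cases hf : f 0 = f 1
    · refine ⟨fun x => ⟨x, by omega⟩, fun x y h => by simpa [Fin.ext_iff] using h, fun x h => ?_⟩
      rw [blockCost_eq_zero] at h
      have h0 := h.2 0
      have h1 := h.2 1
      rw [← hf, ← h0] at h1
      have hx := x.2
      simp [noInstance] at h1
      omega
    · refine ⟨fun x => ⟨x + (k + 1), by omega⟩, fun x y h => by simpa [Fin.ext_iff] using h,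
        fun x h => ?_⟩
      rw [blockCost_eq_zero] at h
      have hx : k < x + (k + 1) := by omega
      have h0 := (h.2 0).1 (by simp [noInstance])
      have h1 := (h.2 1).1 (by simp [noInstance, hx])
      exact hf (Finset.card_le_one.1 h.1 _ h0 _ h1)
  obtain ⟨e, he, hne⟩ := key
  have h2 : Finset.univ.map ⟨e, he⟩ ⊆ Finset.univ.filter fun b => blockCost f (S b)
      (fun a => (noInstance k).adj a b) ≠ 0 := by
    intro b hb
    obtain ⟨x, -, rfl⟩ := Finset.mem_map.1 hb
    exact Finset.mem_filter.2 ⟨Finset.mem_univ _, hne x⟩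
  have h3 := (Finset.card_le_card h2).trans h1
  simp at h3

theorem bceovs_of_isEmpty {G : BipGraph} (h : IsEmpty (Fin G.numB)) (k : ℕ) : BCEOVS G k :=
  ⟨0, G, Nat.zero_le _, .nil G, fun _ => 0, fun b => h.elim b, fun _ b => h.elim b⟩

/-! ### Solutions as bit matrices -/

section Codes

variable {m n : ℕ} (adj : Fin m → Fin n → Bool) (k : ℕ)

theorem sum_toNat_eq_card {ι : Type*} [Fintype ι] (p : ι → Bool) :
    ∑ i, (p i).toNat = (Finset.univ.filter fun i => p i = true).card := by
  rw [Finset.card_filter]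
  exact Finset.sum_congr rfl fun i _ => by cases p i <;> simp

/-- The sum of the costs of the vertices of `B` if `RA` and `RB` describe the blocks. -/
def relCost (RA : Fin m → Fin (m + 1) → Bool) (RB : Fin n → Fin (m + 1) → Bool) : ℕ :=
  ∑ b, ((∑ i, (RB b i).toNat - 1) +
    ∑ a, if (adj a b = true ↔ ∃ i, RA a i = true ∧ RB b i = true) then 0 else 1)

/-- At most `m` blocks contain vertices of `A`. The map `π` keeps these apart and merges all other
blocks into `Fin.last m`; this preserves mismatches and does not enlarge the sets `S b`. The extra
column is needed because `S b` must stay nonempty. -/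
theorem Solvable.exists_rel {adj : Fin m → Fin n → Bool} {k : ℕ} (h : Solvable adj k) :
    ∃ (RA : Fin m → Fin (m + 1) → Bool) (RB : Fin n → Fin (m + 1) → Bool),
      (∀ a, ∑ i, (RA a i).toNat = 1) ∧ (∀ b, 1 ≤ ∑ i, (RB b i).toNat) ∧ relCost adj RA RB ≤ k := by
  obtain ⟨f, S, hS, hk⟩ := h
  classical
  let π : ℕ → Fin (m + 1) := fun x =>
    if h : ∃ a, f a = x then Fin.castSucc h.choose else Fin.last m
  have hπ : ∀ a x, π (f a) = π x → f a = x := by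
    intro a x h
    have h1 : ∃ a', f a' = f a := ⟨a, rfl⟩
    have h1' := h1.choose_spec
    simp only [π, dif_pos h1] at h
    split_ifs at h with h2
    · have h2' := h2.choose_spec
      rw [Fin.castSucc_inj] at h
      rw [← h1', ← h2', h]
    · exact absurd h (Fin.castSucc_lt_last _).ne
  refine ⟨fun a i => decide (π (f a) = i), fun b i => decide (i ∈ (S b).image π), ?_, ?_, ?_⟩
  · intro a
    rw [sum_toNat_eq_card]
    simp [Finset.filter_eq]
  · intro b
    rw [sum_toNat_eq_card]
    simp only [decide_eq_true_eq, Finset.filter_univ_mem]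
    exact ((hS b).image π).card_pos
  · refine (Finset.sum_le_sum fun b _ => Nat.add_le_add ?_ ?_).trans hk
    · rw [sum_toNat_eq_card]
      simp only [decide_eq_true_eq, Finset.filter_univ_mem]
      exact Nat.sub_le_sub_right Finset.card_image_le 1
    · rw [Finset.card_filter]
      refine Finset.sum_le_sum fun a _ => ?_
      have : (∃ i, decide (π (f a) = i) = true ∧ decide (i ∈ (S b).image π) = true) ↔
          f a ∈ S b := by
        simp only [decide_eq_true_eq, exists_eq_left', Finset.mem_image]
        refine ⟨?_, fun h => ⟨_, h, rfl⟩⟩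
        rintro ⟨x, hx, h⟩
        rwa [hπ a x h.symm]
      rw [if_congr (iff_congr Iff.rfl this) rfl rfl]
      by_cases h : adj a b = true ↔ f a ∈ S b <;> simp [h]

theorem solvable_of_rel {adj : Fin m → Fin n → Bool} {k : ℕ}
    {RA : Fin m → Fin (m + 1) → Bool} {RB : Fin n → Fin (m + 1) → Bool}
    (hA : ∀ a, ∑ i, (RA a i).toNat = 1) (hB : ∀ b, 1 ≤ ∑ i, (RB b i).toNat)
    (h : relCost adj RA RB ≤ k) : Solvable adj k := by
  have hf : ∀ a, ∃ i, ∀ j, RA a j = true ↔ j = i := by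
    intro a
    have h1 := hA a
    rw [sum_toNat_eq_card, Finset.card_eq_one] at h1
    obtain ⟨i, hi⟩ := h1
    refine ⟨i, fun j => ?_⟩
    rw [show j = i ↔ j ∈ ({i} : Finset _) from Finset.mem_singleton.symm, ← hi]
    simp
  choose f hf using hf
  refine ⟨fun a => f a, fun b => (Finset.univ.filter fun i => RB b i = true).map Fin.valEmbedding,
    fun b => ?_, ?_⟩
  · have := hB b
    rw [sum_toNat_eq_card] at this
    simpa only [Finset.map_nonempty] using Finset.card_pos.1 this
  · refine le_trans (Finset.sum_le_sum fun b _ => Nat.add_le_add ?_ ?_) h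
    · rw [Finset.card_map, sum_toNat_eq_card]
    · rw [Finset.card_filter]
      refine Finset.sum_le_sum fun a _ => ?_
      have : (∃ i, RA a i = true ∧ RB b i = true) ↔
          (f a : ℕ) ∈ (Finset.univ.filter fun i => RB b i = true).map Fin.valEmbedding := by
        simp only [hf, exists_eq_left, Finset.mem_map, Finset.mem_filter, Finset.mem_univ, true_and,
          Fin.valEmbedding_apply, Fin.val_inj, exists_eq_right]
      rw [if_congr (iff_congr Iff.rfl this) rfl rfl]
      by_cases h : adj a b = true ↔ (f a : ℕ) ∈
        (Finset.univ.filter fun i => RB b i = true).map Fin.valEmbedding <;> simp only [h] <;> simp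

/-- The bit of the code `X` in row `r` and column `i`, in a matrix with `m + 1` columns. -/
def codeBit (m X r i : ℕ) : Bool := X.testBit (r * (m + 1) + i)

theorem exists_code {r m : ℕ} (R : Fin r → Fin (m + 1) → Bool) :
    ∃ X < 2 ^ (r * (m + 1)), ∀ x i, codeBit m X (x : Fin r).val (i : Fin (m + 1)).val = R x i := by
  refine ⟨Nat.ofBits fun p : Fin (r * (m + 1)) => R (finProdFinEquiv.symm p).1
    (finProdFinEquiv.symm p).2, Nat.ofBits_lt_two_pow _, fun x i => ?_⟩
  have h : (x : ℕ) * (m + 1) + i = (finProdFinEquiv (x, i) : ℕ) := by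
    simp only [finProdFinEquiv_apply_val]
    ring
  rw [codeBit, h, Nat.testBit_ofBits_lt _ _ (Fin.isLt _)]
  simp only [Fin.eta, Equiv.symm_apply_apply]

/-- The numbers of violations and excess costs of the solution with code `X`. -/
def codeDefect (X : ℕ) : ℕ :=
  (∑ a : Fin m, ((∑ i : Fin (m + 1), (codeBit m X a i).toNat - 1) +
      (1 - ∑ i : Fin (m + 1), (codeBit m X a i).toNat)) +
    ∑ b : Fin n, (1 - ∑ i : Fin (m + 1), (codeBit m X (m + b) i).toNat)) +
  (relCost adj (fun a i => codeBit m X a i) (fun b i => codeBit m X (m + b) i) - k)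

/-- The first `m` rows of the code describe `A`, the next `n` rows describe `B`. With truncated
subtraction, `(x - 1) + (1 - x)`, `1 - x` and `x - k` vanish iff `x = 1`, `1 ≤ x` and `x ≤ k`
respectively. -/
theorem solvable_iff_exists_code :
    Solvable adj k ↔ ∃ X < 2 ^ ((m + n) * (m + 1)), codeDefect adj k X = 0 := by
  constructor
  · intro h
    obtain ⟨RA, RB, h1, h2, h3⟩ := h.exists_rel
    obtain ⟨X, hX, h⟩ := exists_code (Fin.addCases RA RB)
    have hA : ∀ a i, codeBit m X (a : Fin m).val (i : Fin (m + 1)).val = RA a i := by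
      intro a i
      have := h (Fin.castAdd n a) i
      simpa using this
    have hB : ∀ b i, codeBit m X (m + (b : Fin n).val) (i : Fin (m + 1)).val = RB b i := by
      intro b i
      have := h (Fin.natAdd m b) i
      simpa using this
    refine ⟨X, hX, ?_⟩
    simp only [codeDefect, hA, hB, h1]
    simp [h2, Nat.sub_eq_zero_of_le, h3]
  · rintro ⟨X, -, h⟩
    simp only [codeDefect, Nat.add_eq_zero_iff, Finset.sum_eq_zero_iff, Finset.mem_univ,
      forall_true_left] at h
    refine solvable_of_rel (fun a => ?_) (fun b => ?_) (Nat.sub_eq_zero_iff_le.1 h.2)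
    · have := h.1.1 a
      omega
    · have := h.1.2 b
      omega

end Codes

/-! ### Program logic with time bounds -/

namespace RAM

@[simp] theorem State.setVar_var (s : State) (x v y : ℕ) :
    (s.setVar x v).var y = if y = x then v else s.var y := by
  simp [State.setVar, Function.update_apply]

@[simp] theorem State.setVar_arr (s : State) (x v : ℕ) : (s.setVar x v).arr = s.arr := rfl

@[simp] theorem State.setArr_var (s : State) (t i v : ℕ) : (s.setArr t i v).var = s.var := rfl

@[simp] theorem State.setArr_arr (s : State) (t i v u j : ℕ) :
    (s.setArr t i v).arr u j = if u = t ∧ j = i then v else s.arr u j := by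
  by_cases hu : u = t
  · subst hu
    simp [State.setArr, Function.update_apply]
  · simp [State.setArr, hu]

/-- Started in `s`, the program `p` halts after at most `c` steps in a state satisfying `Q`. -/
def Exec (p : Prog) (s : State) (c : ℕ) (Q : State → Prop) : Prop :=
  ∃ n s', Runs p s n s' ∧ n ≤ c ∧ Q s'

theorem Exec.mono {p : Prog} {s : State} {c c' : ℕ} {Q Q' : State → Prop} (h : Exec p s c Q)
    (hc : c ≤ c') (hQ : ∀ s', Q s' → Q' s') : Exec p s c' Q' := by
  obtain ⟨n, s', h1, h2, h3⟩ := h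
  exact ⟨n, s', h1, h2.trans hc, hQ s' h3⟩

theorem Exec.seq {p q : Prog} {s : State} {c c' : ℕ} {Q Q' : State → Prop} (h : Exec p s c Q)
    (h' : ∀ s', Q s' → Exec q s' c' Q') : Exec (.seq p q) s (c + c') Q' := by
  obtain ⟨n, s', h1, h2, h3⟩ := h
  obtain ⟨n', s'', h4, h5, h6⟩ := h' s' h3
  exact ⟨n + n', s'', .seq h1 h4, Nat.add_le_add h2 h5, h6⟩

theorem Exec.const {s : State} {x c : ℕ} {Q : State → Prop} (h : Q (s.setVar x c)) :
    Exec (.const x c) s 1 Q := ⟨1, _, .const s x c, le_rfl, h⟩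

theorem Exec.add {s : State} {x y z : ℕ} {Q : State → Prop}
    (h : Q (s.setVar x (s.var y + s.var z))) : Exec (.add x y z) s 1 Q :=
  ⟨1, _, .add s x y z, le_rfl, h⟩

theorem Exec.sub {s : State} {x y z : ℕ} {Q : State → Prop}
    (h : Q (s.setVar x (s.var y - s.var z))) : Exec (.sub x y z) s 1 Q :=
  ⟨1, _, .sub s x y z, le_rfl, h⟩

theorem Exec.read {s : State} {x t y : ℕ} {Q : State → Prop}
    (h : Q (s.setVar x (s.arr t (s.var y)))) : Exec (.read x t y) s 1 Q :=
  ⟨1, _, .read s x t y, le_rfl, h⟩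

theorem Exec.write {s : State} {t x y : ℕ} {Q : State → Prop}
    (h : Q (s.setArr t (s.var x) (s.var y))) : Exec (.write t x y) s 1 Q :=
  ⟨1, _, .write s t x y, le_rfl, h⟩

theorem Exec.const_seq {s : State} {x c n : ℕ} {q : Prog} {Q : State → Prop}
    (h : Exec q (s.setVar x c) n Q) : Exec (.seq (.const x c) q) s (1 + n) Q :=
  (Exec.const (Q := fun s' => s' = _) rfl).seq fun _ hs => hs ▸ h

theorem Exec.add_seq {s : State} {x y z n : ℕ} {q : Prog} {Q : State → Prop}
    (h : Exec q (s.setVar x (s.var y + s.var z)) n Q) : Exec (.seq (.add x y z) q) s (1 + n) Q :=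
  (Exec.add (Q := fun s' => s' = _) rfl).seq fun _ hs => hs ▸ h

theorem Exec.sub_seq {s : State} {x y z n : ℕ} {q : Prog} {Q : State → Prop}
    (h : Exec q (s.setVar x (s.var y - s.var z)) n Q) : Exec (.seq (.sub x y z) q) s (1 + n) Q :=
  (Exec.sub (Q := fun s' => s' = _) rfl).seq fun _ hs => hs ▸ h

theorem Exec.write_seq {s : State} {t x y n : ℕ} {q : Prog} {Q : State → Prop}
    (h : Exec q (s.setArr t (s.var x) (s.var y)) n Q) : Exec (.seq (.write t x y) q) s (1 + n) Q :=
  (Exec.write (Q := fun s' => s' = _) rfl).seq fun _ hs => hs ▸ h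

theorem Exec.ite {s : State} {x c : ℕ} {p q : Prog} {Q : State → Prop}
    (hp : s.var x ≠ 0 → Exec p s c Q) (hq : s.var x = 0 → Exec q s c Q) :
    Exec (.ite x p q) s (c + 1) Q := by
  by_cases hx : s.var x = 0
  · obtain ⟨n, s', h1, h2, h3⟩ := hq hx
    exact ⟨n + 1, s', .ite_false hx h1, Nat.add_le_add_right h2 1, h3⟩
  · obtain ⟨n, s', h1, h2, h3⟩ := hp hx
    exact ⟨n + 1, s', .ite_true hx h1, Nat.add_le_add_right h2 1, h3⟩

/-- The rule for loops: `I i` holds if `i` rounds are left. -/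
theorem Exec.loop {x c : ℕ} {p : Prog} (I : ℕ → State → Prop)
    (h0 : ∀ s, I 0 s → s.var x = 0)
    (h : ∀ i s, I (i + 1) s → s.var x ≠ 0 ∧ Exec p s c (I i)) :
    ∀ m s, I m s → Exec (.loop x p) s (m * (c + 1) + 1) (I 0) := by
  intro m
  induction m with
  | zero => exact fun s hs => ⟨1, s, by constructor; exact h0 s hs, by omega, hs⟩
  | succ m ih =>
    intro s hs
    obtain ⟨hx, n, s', h1, h2, h3⟩ := h m s hs
    obtain ⟨n', s'', h4, h5, h6⟩ := ih s' h3
    refine ⟨n + n' + 1, s'', .loop_next hx h1 h4, ?_, h6⟩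
    rw [Nat.succ_mul]
    omega

/-! ### Arithmetic expressions and their compilation -/

/-- Arithmetic expressions with bounded sums. -/
inductive Expr where
  | const (c : ℕ)
  | var (x : ℕ)
  | add (e e' : Expr)
  | sub (e e' : Expr)
  | read (t : ℕ) (e : Expr)
  | ite (e e₁ e₂ : Expr)
  | sum (x y : ℕ) (e : Expr)
  | pow2 (y : ℕ)

namespace Expr

/-- The value of an expression; `sum x y e` is the sum of `e` over all values `x < y`. -/
def eval : Expr → State → ℕ
  | const c, _ => c
  | var x, s => s.var x
  | add e e', s => e.eval s + e'.eval s
  | sub e e', s => e.eval s - e'.eval s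
  | read t e, s => s.arr t (e.eval s)
  | ite e e₁ e₂, s => if e.eval s ≠ 0 then e₁.eval s else e₂.eval s
  | sum x y e, s => ∑ i ∈ Finset.range (s.var y), e.eval (s.setVar x i)
  | pow2 y, s => 2 ^ s.var y

/-- All variables have names below `T`, and only the array `r` is read. -/
def Uses (T r : ℕ) : Expr → Bool
  | const _ => true
  | var x => decide (x < T)
  | add e e' => e.Uses T r && e'.Uses T r
  | sub e e' => e.Uses T r && e'.Uses T r
  | read t e => decide (t = r) && e.Uses T r
  | ite e e₁ e₂ => e.Uses T r && (e₁.Uses T r && e₂.Uses T r)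
  | sum x y e => decide (x < T) && (decide (y < T) && e.Uses T r)
  | pow2 y => decide (y < T)

/-- A program that stores the value of an expression in the variable `d`, using only the variables
with names at least `d` (the variables of sums are restored). -/
def compile : Expr → ℕ → Prog
  | const c, d => .const d c
  | var x, d => .seq (.const d 0) (.add d x d)
  | add e e', d => .seq (e.compile d) (.seq (e'.compile (d + 1)) (.add d d (d + 1)))
  | sub e e', d => .seq (e.compile d) (.seq (e'.compile (d + 1)) (.sub d d (d + 1)))
  | read t e, d => .seq (e.compile d) (.read d t d)
  | ite e e₁ e₂, d => .seq (e.compile d) (.ite d (e₁.compile d) (e₂.compile d))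
  | sum x y e, d =>
    .seq (.const d 0) <| .seq (.add (d + 1) x d) <| .seq (.add (d + 2) y d) <|
    .seq (.const x 0) <| .seq (.sub (d + 3) (d + 2) x) <|
    .seq (.loop (d + 3) <|
      .seq (e.compile (d + 4)) <| .seq (.add d d (d + 4)) <| .seq (.const (d + 4) 1) <|
      .seq (.add x x (d + 4)) <| .sub (d + 3) (d + 2) x) <|
    .seq (.const (d + 3) 0) <| .add x (d + 1) (d + 3)
  | pow2 y, d =>
    .seq (.const d 0) <| .seq (.add (d + 1) y d) <| .seq (.const d 1) <| .seq (.const (d + 2) 1) <|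
    .loop (d + 1) <| .seq (.add d d d) <| .sub (d + 1) (d + 1) (d + 2)

/-- The running time on variables bounded by `N` is at most `e.coeff * (N + 1) ^ e.deg`. -/
def coeff : Expr → ℕ
  | const _ => 1
  | var _ => 2
  | add e e' => e.coeff + e'.coeff + 1
  | sub e e' => e.coeff + e'.coeff + 1
  | read _ e => e.coeff + 1
  | ite e e₁ e₂ => e.coeff + e₁.coeff + e₂.coeff + 1
  | sum _ _ e => e.coeff + 13
  | pow2 _ => 8

/-- The degree of the bound for the running time. -/
def deg : Expr → ℕ
  | const _ => 0
  | var _ => 0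
  | add e e' => e.deg + e'.deg
  | sub e e' => e.deg + e'.deg
  | read _ e => e.deg
  | ite e e₁ e₂ => e.deg + e₁.deg + e₂.deg
  | sum _ _ e => e.deg + 1
  | pow2 _ => 1

/-- The bound for the running time. -/
def cost (e : Expr) (N : ℕ) : ℕ := e.coeff * (N + 1) ^ e.deg

/-- This frame property shows that scratch variables with names from `T` on cannot influence the
value of an expression. -/
theorem eval_congr {T r : ℕ} {e : Expr} : ∀ {s s' : State}, e.Uses T r = true →
    (∀ v < T, s.var v = s'.var v) → s.arr r = s'.arr r → e.eval s = e.eval s' := by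
  induction e with
  | const c => intros; rfl
  | var x =>
    intro s s' h hv _
    simp only [Uses, decide_eq_true_eq] at h
    exact hv x h
  | add e e' ih ih' =>
    intro s s' h hv ha
    simp only [Uses, Bool.and_eq_true] at h
    simp only [eval, ih h.1 hv ha, ih' h.2 hv ha]
  | sub e e' ih ih' =>
    intro s s' h hv ha
    simp only [Uses, Bool.and_eq_true] at h
    simp only [eval, ih h.1 hv ha, ih' h.2 hv ha]
  | read t e ih =>
    intro s s' h hv ha
    simp only [Uses, Bool.and_eq_true, decide_eq_true_eq] at h
    simp only [eval, ih h.2 hv ha, h.1, ha]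
  | ite e e₁ e₂ ih ih₁ ih₂ =>
    intro s s' h hv ha
    simp only [Uses, Bool.and_eq_true] at h
    simp only [eval, ih h.1 hv ha, ih₁ h.2.1 hv ha, ih₂ h.2.2 hv ha]
  | sum x y e ih =>
    intro s s' h hv ha
    simp only [Uses, Bool.and_eq_true, decide_eq_true_eq] at h
    simp only [eval, hv y h.2.1]
    refine Finset.sum_congr rfl fun i _ => ih h.2.2 (fun v hvT => ?_) ha
    simp [hv v hvT]
  | pow2 y =>
    intro s s' h hv _
    simp only [Uses, decide_eq_true_eq] at h
    simp only [eval, hv y h]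

end Expr

/-- The states `s` and `s'` have the same arrays and the same variables with names below `d`. -/
def Agree (d : ℕ) (s s' : State) : Prop := (∀ v < d, s'.var v = s.var v) ∧ s'.arr = s.arr

theorem Agree.trans {d d' : ℕ} {s s' s'' : State} (h : Agree d s s') (h' : Agree d' s' s'')
    (hd : d ≤ d') : Agree d s s'' :=
  ⟨fun v hv => (h'.1 v (hv.trans_le hd)).trans (h.1 v hv), h'.2.trans h.2⟩

theorem cost_le_of_deg_le {c D D' N : ℕ} (h : D ≤ D') : c * (N + 1) ^ D ≤ c * (N + 1) ^ D' :=
  Nat.mul_le_mul_left _ (Nat.pow_le_pow_right (Nat.succ_pos N) h)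

-- Data influence the running time only through the ranges of sums and the exponents of `pow2`, and
-- these are variables with names below `T`. Summation indices stay within the range of their sum,
-- so the bound `N` survives inside loops, however large the intermediate results become.
open RAM.Expr in
theorem exec_compile {T r N : ℕ} (e : Expr) : ∀ {d : ℕ} {s : State}, T ≤ d → e.Uses T r = true →
    (∀ v < T, s.var v ≤ N) →
    Exec (e.compile d) s (e.cost N) fun s' => Agree d s s' ∧ s'.var d = e.eval s := by
  induction e with
  | const c =>
    intro d s hd _ _
    refine (Exec.const (Q := fun s' => Agree d s s' ∧ s'.var d = c) ?_).mono
      (by simp [Expr.cost, coeff, deg]) (fun _ h => h)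
    refine ⟨⟨fun v hv => ?_, rfl⟩, by simp⟩
    simp [hv.ne]
  | var x =>
    intro d s hd h _
    simp only [Uses, decide_eq_true_eq] at h
    have hx : x ≠ d := by omega
    refine Exec.mono (Q := fun s' => Agree d s s' ∧ s'.var d = s.var x)
      (Exec.const_seq (Exec.add ?_)) (by simp [Expr.cost, coeff, deg]) (fun _ h => h)
    refine ⟨⟨fun v hv => ?_, rfl⟩, by simp [hx]⟩
    simp [hv.ne]
  | add e e' ih ih' =>
    intro d s hd h hN
    simp only [Uses, Bool.and_eq_true] at h
    refine Exec.mono ((ih hd h.1 hN).seq (c' := e'.cost N + 1)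
      (Q' := fun s' => Agree d s s' ∧ s'.var d = e.eval s + e'.eval s)
      fun s₁ h₁ => (ih' (d := d + 1) (by omega) h.2 ?_).seq fun s₂ h₂ => Exec.add ?_) ?_
      (fun _ h => h)
    · exact fun v hv => (h₁.1.1 v (hv.trans_le hd)).trans_le (hN v hv)
    · have h3 : e'.eval s₁ = e'.eval s :=
        eval_congr h.2 (fun v hv => h₁.1.1 v (hv.trans_le hd)) (by rw [h₁.1.2])
      refine ⟨⟨fun v hv => ?_, by simp [h₂.1.2, h₁.1.2]⟩, ?_⟩
      · simp [hv.ne, h₂.1.1 v (by omega), h₁.1.1 v hv]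
      · simp [h₂.1.1 d (by omega), h₁.2, h₂.2, h3]
    · have h1 := cost_le_of_deg_le (c := e.coeff) (N := N) (Nat.le_add_right e.deg e'.deg)
      have h2 := cost_le_of_deg_le (c := e'.coeff) (N := N) (Nat.le_add_left e'.deg e.deg)
      have h3 := Nat.one_le_pow (e.deg + e'.deg) (N + 1) (Nat.succ_pos N)
      simp only [Expr.cost, coeff, deg, Nat.add_mul]
      omega
  | sub e e' ih ih' =>
    intro d s hd h hN
    simp only [Uses, Bool.and_eq_true] at h
    refine Exec.mono ((ih hd h.1 hN).seq (c' := e'.cost N + 1)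
      (Q' := fun s' => Agree d s s' ∧ s'.var d = e.eval s - e'.eval s)
      fun s₁ h₁ => (ih' (d := d + 1) (by omega) h.2 ?_).seq fun s₂ h₂ => Exec.sub ?_) ?_
      (fun _ h => h)
    · exact fun v hv => (h₁.1.1 v (hv.trans_le hd)).trans_le (hN v hv)
    · have h3 : e'.eval s₁ = e'.eval s :=
        eval_congr h.2 (fun v hv => h₁.1.1 v (hv.trans_le hd)) (by rw [h₁.1.2])
      refine ⟨⟨fun v hv => ?_, by simp [h₂.1.2, h₁.1.2]⟩, ?_⟩
      · simp [hv.ne, h₂.1.1 v (by omega), h₁.1.1 v hv]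
      · simp [h₂.1.1 d (by omega), h₁.2, h₂.2, h3]
    · have h1 := cost_le_of_deg_le (c := e.coeff) (N := N) (Nat.le_add_right e.deg e'.deg)
      have h2 := cost_le_of_deg_le (c := e'.coeff) (N := N) (Nat.le_add_left e'.deg e.deg)
      have h3 := Nat.one_le_pow (e.deg + e'.deg) (N + 1) (Nat.succ_pos N)
      simp only [Expr.cost, coeff, deg, Nat.add_mul]
      omega
  | read t e ih =>
    intro d s hd h hN
    simp only [Uses, Bool.and_eq_true] at h
    refine Exec.mono ((ih hd h.2 hN).seq (c' := 1)
      (Q' := fun s' => Agree d s s' ∧ s'.var d = s.arr t (e.eval s)) fun s₁ h₁ => Exec.read ?_) ?_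
      (fun _ h => h)
    · refine ⟨⟨fun v hv => ?_, by simp [h₁.1.2]⟩, ?_⟩
      · simp [hv.ne, h₁.1.1 v hv]
      · simp [h₁.2, h₁.1.2]
    · have h3 := Nat.one_le_pow e.deg (N + 1) (Nat.succ_pos N)
      simp only [Expr.cost, coeff, deg, Nat.add_mul]
      omega
  | ite e e₁ e₂ ih ih₁ ih₂ =>
    intro d s hd h hN
    simp only [Uses, Bool.and_eq_true] at h
    refine Exec.mono ((ih hd h.1 hN).seq (c' := e₁.cost N + e₂.cost N + 1)
      (Q' := fun s' => Agree d s s' ∧ s'.var d = (Expr.ite e e₁ e₂).eval s) fun s' h' => Exec.ite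
      (fun hd0 => (ih₁ hd h.2.1 ?_).mono (Nat.le_add_right _ _) fun s'' h'' => ?_)
      (fun hd0 => (ih₂ hd h.2.2 ?_).mono (Nat.le_add_left _ _) fun s'' h'' => ?_)) ?_
      (fun _ h => h)
    · exact fun v hv => (h'.1.1 v (hv.trans_le hd)).trans_le (hN v hv)
    · refine ⟨h'.1.trans h''.1 le_rfl, ?_⟩
      rw [h'.2] at hd0
      rw [h''.2, eval, if_pos hd0]
      exact eval_congr h.2.1 (fun v hv => h'.1.1 v (hv.trans_le hd)) (by rw [h'.1.2])
    · exact fun v hv => (h'.1.1 v (hv.trans_le hd)).trans_le (hN v hv)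
    · refine ⟨h'.1.trans h''.1 le_rfl, ?_⟩
      rw [h'.2] at hd0
      rw [h''.2, eval, if_neg (not_not.2 hd0)]
      exact eval_congr h.2.2 (fun v hv => h'.1.1 v (hv.trans_le hd)) (by rw [h'.1.2])
    · have h1 := cost_le_of_deg_le (c := e.coeff) (N := N)
        (show e.deg ≤ e.deg + e₁.deg + e₂.deg by omega)
      have h2 := cost_le_of_deg_le (c := e₁.coeff) (N := N)
        (show e₁.deg ≤ e.deg + e₁.deg + e₂.deg by omega)
      have h3 := cost_le_of_deg_le (c := e₂.coeff) (N := N)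
        (show e₂.deg ≤ e.deg + e₁.deg + e₂.deg by omega)
      have h4 := Nat.one_le_pow (e.deg + e₁.deg + e₂.deg) (N + 1) (Nat.succ_pos N)
      simp only [Expr.cost, coeff, deg, Nat.add_mul]
      omega
  | sum x y e ih =>
    intro d s hd h hN
    simp only [Uses, Bool.and_eq_true, decide_eq_true_eq] at h
    obtain ⟨hx, hy, he⟩ := h
    set m := s.var y with hm
    have hmN : m ≤ N := hN y hy
    have hxd : x < d := by omega
    have hyd : y < d := by omega
    -- The partial sum is in `d`, the old value of `x` (to be restored at the end) in `d + 1`, the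
    -- range in `d + 2`, and the number of rounds left in `d + 3`.
    let I : ℕ → State → Prop := fun i s' => i ≤ m ∧ (∀ v < d, v ≠ x → s'.var v = s.var v) ∧
      s'.arr = s.arr ∧ s'.var d = ∑ j ∈ Finset.range (m - i), e.eval (s.setVar x j) ∧
      s'.var (d + 1) = s.var x ∧ s'.var (d + 2) = m ∧ s'.var (d + 3) = i ∧ s'.var x = m - i
    refine Exec.mono (Q := fun s' => Agree d s s' ∧ s'.var d = (Expr.sum x y e).eval s)
      (Exec.const_seq <| Exec.add_seq <| Exec.add_seq <| Exec.const_seq <| Exec.sub_seq <|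
      ((Exec.loop (c := e.cost N + 4) I ?_ ?_ m _ ?_).seq fun s' hs' => Exec.const_seq <|
      Exec.add ?_)) ?_ (fun _ h => h)
    · exact fun s' hs' => hs'.2.2.2.2.2.2.1
    · rintro i s' ⟨h1, h2, h3, h4, h5, h6, h7, h8⟩
      refine ⟨by omega, ?_⟩
      refine Exec.mono (Q := I i) ((ih (d := d + 4) (by omega) he ?_).seq fun s₁ h₁ =>
        Exec.add_seq <| Exec.const_seq <| Exec.add_seq <| Exec.sub ?_) le_rfl (fun _ h => h)
      · intro v hv
        by_cases hvx : v = x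
        · subst hvx
          omega
        · exact (h2 v (by omega) hvx).trans_le (hN v hv)
      · have hev : e.eval s' = e.eval (s.setVar x (m - (i + 1))) := by
          refine eval_congr he (fun v hv => ?_) (by simp [h3])
          by_cases hvx : v = x
          · simp [hvx, h8]
          · simp [hvx, h2 v (by omega) hvx]
        have hv : ∀ v < d + 4, s₁.var v = s'.var v := h₁.1.1
        have hxd' : x ≠ d ∧ x ≠ d + 1 ∧ x ≠ d + 2 ∧ x ≠ d + 3 ∧ x ≠ d + 4 := by omega
        have hxd'' : d ≠ x ∧ d + 1 ≠ x ∧ d + 2 ≠ x ∧ d + 3 ≠ x ∧ d + 4 ≠ x := by omega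
        refine ⟨by omega, fun v hvd hvx => ?_, by simp [h₁.1.2, h3], ?_, ?_, ?_, ?_, ?_⟩
        · have : v ≠ d ∧ v ≠ d + 3 ∧ v ≠ d + 4 := by omega
          simp [this, hvx, hv v (by omega), h2 v hvd hvx]
        · have hmi : m - i = m - (i + 1) + 1 := by omega
          rw [hmi, Finset.sum_range_succ, ← hev, ← h4]
          simp [hxd'', hv d (by omega), h₁.2]
        · simp [hxd'', hv (d + 1) (by omega), h5]
        · simp [hxd'', hv (d + 2) (by omega), h6]
        · simp [hxd', hxd'', hv (d + 2) (by omega), hv x (by omega), h6, h8]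
          omega
        · simp [hxd', hv x (by omega), h8]
          omega
    · have hxd' : x ≠ d ∧ x ≠ d + 1 ∧ x ≠ d + 2 ∧ x ≠ d + 3 := by omega
      have hxd'' : d ≠ x ∧ d + 1 ≠ x ∧ d + 2 ≠ x ∧ d + 3 ≠ x := by omega
      have hyd' : y ≠ d ∧ y ≠ d + 1 := by omega
      refine ⟨le_rfl, fun v hvd hvx => ?_, rfl, ?_, ?_, ?_, ?_, ?_⟩
      · have : v ≠ d ∧ v ≠ d + 1 ∧ v ≠ d + 2 ∧ v ≠ d + 3 := by omega
        simp [this, hvx]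
      all_goals simp [hxd', hxd'', hyd', hm]
    · obtain ⟨h1, h2, h3, h4, h5, h6, h7, h8⟩ := hs'
      have hxd'' : d ≠ x ∧ d + 1 ≠ x ∧ d + 2 ≠ x ∧ d + 3 ≠ x := by omega
      refine ⟨⟨fun v hv => ?_, by simp [h3]⟩, ?_⟩
      · by_cases hvx : v = x
        · simp [hvx, h5]
        · have : v ≠ d + 3 := by omega
          simp [this, hvx, h2 v hv hvx]
      · simp [hxd'', h4, eval, hm]
    · have h1 : m * (e.cost N + 4 + 1) ≤ N * (e.cost N + 4 + 1) := Nat.mul_le_mul_right _ hmN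
      have h2 := Nat.one_le_pow e.deg (N + 1) (Nat.succ_pos N)
      have h3 : (Expr.sum x y e).cost N = (N + 1) * (e.cost N + 13 * (N + 1) ^ e.deg) := by
        simp only [Expr.cost, coeff, deg, pow_succ]
        ring
      rw [h3]
      nlinarith
  | pow2 y =>
    intro d s hd h hN
    simp only [Uses, decide_eq_true_eq] at h
    set m := s.var y with hm
    have hmN : m ≤ N := hN y h
    let I : ℕ → State → Prop := fun i s' => i ≤ m ∧ Agree d s s' ∧ s'.var d = 2 ^ (m - i) ∧
      s'.var (d + 1) = i ∧ s'.var (d + 2) = 1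
    refine Exec.mono (Exec.const_seq <| Exec.add_seq <| Exec.const_seq <| Exec.const_seq <|
      Exec.loop (c := 2) I ?_ ?_ m _ ?_) ?_ (fun s' h => ?_)
    · exact fun s' hs' => hs'.2.2.2.1
    · rintro i s' ⟨h1, h2, h3, h4, h5⟩
      refine ⟨by omega, Exec.add_seq <| Exec.sub ?_⟩
      refine ⟨by omega, ⟨fun v hv => ?_, h2.2⟩, ?_, ?_, ?_⟩
      · have : v ≠ d ∧ v ≠ d + 1 := by omega
        simp [this, h2.1 v hv]
      · have hmi : m - i = m - (i + 1) + 1 := by omega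
        rw [hmi, pow_succ, ← h3]
        simp
        omega
      · simp [h4, h5]
      · simp [h5]
    · have : y ≠ d := by omega
      refine ⟨le_rfl, ⟨fun v hv => ?_, rfl⟩, ?_, ?_, ?_⟩
      · have : v ≠ d ∧ v ≠ d + 1 ∧ v ≠ d + 2 := by omega
        simp [this]
      all_goals simp [this, hm]
    · simp only [Expr.cost, coeff, deg, pow_one]
      omega
    · exact ⟨h.2.1, by simpa [eval] using h.2.2.1⟩

end RAM

/-! ### Assignments, array filling and output of a graph -/

namespace RAM

/-- All variables with names below `100` have values at most `N`. -/
def State.BoundedBy (s : State) (N : ℕ) : Prop := ∀ v < 100, s.var v ≤ N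

theorem State.BoundedBy.mono {s : State} {N N' : ℕ} (h : s.BoundedBy N) (hN : N ≤ N') :
    s.BoundedBy N' := fun v hv => (h v hv).trans hN

theorem State.BoundedBy.setVar {s : State} {N x w : ℕ} (h : s.BoundedBy N) (hw : w ≤ N) :
    (s.setVar x w).BoundedBy N := by
  intro v hv
  rw [State.setVar_var]
  split_ifs
  · exact hw
  · exact h v hv

theorem State.BoundedBy.of_agree {s s' : State} {N d : ℕ} (h : s.BoundedBy N) (h' : Agree d s s')
    (hd : 100 ≤ d) : s'.BoundedBy N := fun v hv =>
  (h'.1 v (hv.trans_le hd)).trans_le (h v hv)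

theorem State.IsOutput.of_eq {s s' : State} {G : BipGraph} {k : ℕ} (h : s.IsOutput G k)
    (h0 : s'.var 0 = s.var 0) (h1 : s'.var 1 = s.var 1) (h2 : s'.var 2 = s.var 2)
    (ha : s'.arr 0 = s.arr 0) : s'.IsOutput G k := by
  obtain ⟨g0, g1, g2, g3⟩ := h
  exact ⟨h0.trans g0, h1.trans g1, h2.trans g2, fun a b => by rw [ha, g3]⟩

theorem State.IsOutput.setVar {s : State} {G : BipGraph} {k : ℕ} (h : s.IsOutput G k) {x : ℕ}
    (hx : 3 ≤ x) (v : ℕ) : (s.setVar x v).IsOutput G k := by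
  have : 0 ≠ x ∧ 1 ≠ x ∧ 2 ≠ x := by omega
  exact h.of_eq (by simp [this]) (by simp [this]) (by simp [this]) rfl

theorem State.IsOutput.of_agree {s s' : State} {G : BipGraph} {k d : ℕ} (h : s.IsOutput G k)
    (h' : Agree d s s') (hd : 3 ≤ d) : s'.IsOutput G k :=
  h.of_eq (h'.1 0 (by omega)) (h'.1 1 (by omega)) (h'.1 2 (by omega)) (by rw [h'.2])

theorem index_inj {m n : ℕ} {a a' : Fin m} {b b' : Fin n} :
    a.val * n + b.val = a'.val * n + b'.val ↔ (a, b) = (a', b') := by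
  rw [← finProdFinEquiv.injective.eq_iff, Fin.ext_iff, finProdFinEquiv_apply_val,
    finProdFinEquiv_apply_val]
  simp only [Nat.mul_comm _ n, Nat.add_comm]

theorem State.input_isOutput (G : BipGraph) (k : ℕ) : (State.input G k).IsOutput G k := by
  refine ⟨rfl, rfl, rfl, fun a b => ?_⟩
  simp only [State.input]
  refine if_congr ⟨?_, fun h => ⟨a, b, trivial, rfl, h⟩⟩ rfl rfl
  rintro ⟨a', b', -, h1, h2⟩
  obtain ⟨rfl, rfl⟩ := Prod.mk.inj (index_inj.1 h1)
  exact h2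

theorem State.input_boundedBy (G : BipGraph) (k : ℕ) :
    (State.input G k).BoundedBy (G.order + k) := by
  intro v _
  simp only [State.input, BipGraph.order]
  split_ifs <;> omega

/-- The program `x := e`. -/
def assign (x : ℕ) (e : Expr) : Prog :=
  .seq (e.compile 100) <| .seq (.const 101 0) <| .add x 100 101

theorem exec_assign {r N x : ℕ} {e : Expr} {s : State} (he : e.Uses 100 r = true)
    (hN : s.BoundedBy N) :
    Exec (assign x e) s (e.cost N + 2) fun s' => Agree 100 (s.setVar x (e.eval s)) s' := by
  refine (exec_compile e le_rfl he hN).seq fun s' h' => Exec.const_seq <| Exec.add ?_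
  refine ⟨fun v hv => ?_, by simp [h'.1.2]⟩
  have : v ≠ 101 := by omega
  by_cases hvx : v = x
  · simp [hvx, h'.2]
  · simp [hvx, this, h'.1.1 v hv]

/-- The program `for x < y do t[x] := e`. -/
def fill (t x y : ℕ) (e : Expr) : Prog :=
  .seq (.const x 0) <| .seq (.sub 100 y x) <| .loop 100 <|
    .seq (e.compile 101) <| .seq (.write t x 101) <| .seq (.const 101 1) <|
    .seq (.add x x 101) <| .sub 100 y x

/-- Since `e` does not read the array `t` being written, every entry is computed from the original
contents. -/
theorem exec_fill {r N t x y : ℕ} {e : Expr} {s : State} (hx : x < 100) (hy : y < 100)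
    (hxy : x ≠ y) (ht : t ≠ r) (he : e.Uses 100 r = true) (hN : s.BoundedBy N) :
    Exec (fill t x y e) s ((e.coeff + 8) * (N + 1) ^ (e.deg + 1)) fun s' =>
      (∀ v < 100, v ≠ x → s'.var v = s.var v) ∧ (∀ u, u ≠ t → s'.arr u = s.arr u) ∧
      (∀ i < s.var y, s'.arr t i = e.eval (s.setVar x i)) ∧ s'.BoundedBy N := by
  set m := s.var y with hm
  have hmN : m ≤ N := hN y hy
  have hx' : x ≠ 100 ∧ x ≠ 101 ∧ 100 ≠ x ∧ 101 ≠ x := by omega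
  have hy' : y ≠ 100 ∧ y ≠ 101 ∧ y ≠ x := by omega
  let I : ℕ → State → Prop := fun i s' => i ≤ m ∧ (∀ v < 100, v ≠ x → s'.var v = s.var v) ∧
    (∀ u, u ≠ t → s'.arr u = s.arr u) ∧ (∀ j < m - i, s'.arr t j = e.eval (s.setVar x j)) ∧
    s'.var 100 = i ∧ s'.var x = m - i
  refine Exec.mono (Exec.const_seq <| Exec.sub_seq <|
    Exec.loop (c := e.cost N + 4) I ?_ ?_ m _ ?_) ?_ (fun s' h => ?_)
  · exact fun s' hs' => hs'.2.2.2.2.1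
  · rintro i s' ⟨h1, h2, h3, h4, h5, h6⟩
    refine ⟨by omega, ?_⟩
    refine Exec.mono (Q := I i) ((exec_compile e (T := 100) (d := 101) (N := N) (by omega) he
      ?_).seq fun s₁ h₁ => Exec.write_seq <| Exec.const_seq <| Exec.add_seq <| Exec.sub ?_) le_rfl
      (fun _ h => h)
    · intro v hv
      by_cases hvx : v = x
      · subst hvx
        omega
      · exact (h2 v (by omega) hvx).trans_le (hN v hv)
    · have hev : e.eval s' = e.eval (s.setVar x (m - (i + 1))) := by
        refine Expr.eval_congr he (fun v hv => ?_) (by simp [h3 r ht.symm])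
        by_cases hvx : v = x
        · simp [hvx, h6]
        · simp [hvx, h2 v (by omega) hvx]
      have hv : ∀ v < 101, s₁.var v = s'.var v := h₁.1.1
      refine ⟨by omega, fun v hvd hvx => ?_, fun u hu => ?_, fun j hj => ?_, ?_, ?_⟩
      · have : v ≠ 100 ∧ v ≠ 101 := by omega
        simp [this, hvx, hv v (by omega), h2 v hvd hvx]
      · funext j
        simp [hu, h₁.1.2, h3]
      · by_cases hj' : j = m - (i + 1)
        · simp [hj', hv x (by omega), h6, h₁.2, hev]
        · simp [hj', hv x (by omega), h6, h₁.1.2, h4 j (by omega)]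
      · simp [hx', hy', hv y (by omega), hv x (by omega), h6, h2 y hy hxy.symm]
        omega
      · simp [hx', hv x (by omega), h6]
        omega
  · refine ⟨le_rfl, fun v hvd hvx => ?_, fun u _ => rfl, fun j hj => by omega, ?_, ?_⟩
    · have : v ≠ 100 := by omega
      simp [this, hvx]
    all_goals simp [hx', hy', hm]
  · have h1 : m * (e.cost N + 4 + 1) ≤ N * (e.cost N + 4 + 1) := Nat.mul_le_mul_right _ hmN
    have h2 := Nat.one_le_pow e.deg (N + 1) (Nat.succ_pos N)
    have h3 : (e.coeff + 8) * (N + 1) ^ (e.deg + 1) =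
        (N + 1) * (e.cost N + 8 * (N + 1) ^ e.deg) := by
      simp only [Expr.cost, pow_succ]
      ring
    rw [h3]
    nlinarith
  · obtain ⟨-, h2, h3, h4, -, h6⟩ := h
    refine ⟨h2, h3, h4, fun v hv => ?_⟩
    by_cases hvx : v = x
    · subst hvx
      omega
    · exact (h2 v hv hvx).trans_le (hN v hv)

/-- The expression with the value `1` if `e` and `e'` are equal, and `0` otherwise. -/
def Expr.eq (e e' : Expr) : Expr :=
  .sub (.const 1) (.add (.sub e e') (.sub e' e))

theorem Expr.eval_eq (e e' : Expr) (s : State) :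
    (e.eq e').eval s = if e.eval s = e'.eval s then 1 else 0 := by
  simp only [Expr.eq, eval]
  split_ifs <;> omega

theorem Expr.eval_ite (e e₁ e₂ : Expr) (s : State) :
    (e.ite e₁ e₂).eval s = if e.eval s ≠ 0 then e₁.eval s else e₂.eval s := rfl

theorem Expr.eval_sum {x y n : ℕ} {e : Expr} {s : State} (F : Fin n → ℕ) (hy : s.var y = n)
    (h : ∀ i : Fin n, e.eval (s.setVar x i) = F i) : (Expr.sum x y e).eval s = ∑ i, F i := by
  rw [eval, hy, Finset.sum_range]
  exact Finset.sum_congr rfl fun i _ => h i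

/-- Products, such as those in matrix indices, are obtained by repeated addition. -/
theorem Expr.eval_sum_const {x y z : ℕ} {s : State} (hxz : z ≠ x) :
    (Expr.sum x y (.var z)).eval s = s.var y * s.var z := by
  simp [eval, hxz]

/-- The entry of the new biadjacency matrix, which has `var 6` columns, at the position `var 8`. -/
def entry (eAdj : Expr) : Expr :=
  .sum 3 5 <| .sum 4 6 <| .ite (.eq (.add (.sum 9 3 (.var 6)) (.var 4)) (.var 8)) eAdj (.const 0)

/-- The program that replaces the instance in the memory by the graph with `eA + eB` vertices and
the adjacency `eAdj`, which refers to the indices in the variables `3` and `4`. -/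
def outputGraph (eA eB eAdj : Expr) : Prog :=
  .seq (assign 5 eA) <| .seq (assign 6 eB) <| .seq (assign 7 (.sum 9 5 (.var 6))) <|
  .seq (fill 1 8 7 (entry eAdj)) <| .seq (fill 0 8 7 (.read 1 (.var 8))) <|
  .seq (assign 0 (.var 5)) (assign 1 (.var 6))

/-- The time bound for `outputGraph`. -/
def outputGraphCost (eA eB eAdj : Expr) (N : ℕ) : ℕ :=
  (eA.cost N + 2) + ((eB.cost N + 2) + (((Expr.sum 9 5 (.var 6)).cost N + 2) +
    (((entry eAdj).coeff + 8) * (N + 1) ^ ((entry eAdj).deg + 1) +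
    (((Expr.read 1 (.var 8)).coeff + 8) * (N + 1) ^ ((Expr.read 1 (.var 8)).deg + 1) +
    (((Expr.var 5).cost N + 2) + ((Expr.var 6).cost N + 2))))))

/-- The position in `var 8` is decoded without division: among all pairs of a row and a column,
exactly one has this index (`index_inj`), and only its term survives. -/
theorem eval_entry {G G' : BipGraph} {k : ℕ} {eAdj : Expr} {s : State} (hs : s.IsOutput G k)
    (hAdj : ∀ s : State, s.IsOutput G k → ∀ i j, s.var 3 = (i : Fin G'.numA).val →
      s.var 4 = (j : Fin G'.numB).val → eAdj.eval s = if G'.adj i j = true then 1 else 0)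
    (h5 : s.var 5 = G'.numA) (h6 : s.var 6 = G'.numB) (i : Fin G'.numA) (j : Fin G'.numB) :
    (entry eAdj).eval (s.setVar 8 (i.val * G'.numB + j.val)) =
      if G'.adj i j = true then 1 else 0 := by
  rw [entry, Expr.eval_sum (n := G'.numA) (fun i' => ∑ j' : Fin G'.numB, if (i', j') = (i, j) then
    (if G'.adj i j = true then 1 else 0) else 0) (by simp [h5])]
  · rw [← Fintype.sum_prod_type', Finset.sum_ite_eq' Finset.univ (i, j)]
    simp
  · intro i'
    refine Expr.eval_sum _ (by simp [h6]) fun j' => ?_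
    set s' := ((s.setVar 8 (i.val * G'.numB + j.val)).setVar 3 i').setVar 4 j' with hs'
    have o : s'.IsOutput G k :=
      ((hs.setVar (by omega) _).setVar (by omega) _).setVar (by omega) _
    have h1 : ((Expr.sum 9 3 (.var 6)).add (.var 4)).eval s' = i'.val * G'.numB + j'.val := by
      rw [Expr.eval, Expr.eval_sum_const (by omega)]
      simp [hs', h6, Expr.eval]
    have h2 : (Expr.var 8).eval s' = i.val * G'.numB + j.val := by simp [hs', Expr.eval]
    rw [Expr.eval_ite, Expr.eval_eq, h1, h2, hAdj s' o i' j' (by simp [hs']) (by simp [hs'])]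
    by_cases h : (i', j') = (i, j)
    · obtain ⟨rfl, rfl⟩ := Prod.mk.inj h
      simp
    · rw [if_neg (mt index_inj.1 h), if_neg h]
      rfl

/-- The new matrix is built in the array `1` and then copied, because its entries depend on the old
matrix in the array `0`. For the same reason the old dimensions in the variables `0` and `1` are
overwritten last. -/
theorem exec_outputGraph {G G' : BipGraph} {k N : ℕ} {eA eB eAdj : Expr} {s : State}
    (hs : s.IsOutput G k) (hN : s.BoundedBy N)
    (uA : eA.Uses 100 0 = true) (uB : eB.Uses 100 0 = true) (uAdj : eAdj.Uses 100 0 = true)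
    (hA : ∀ s : State, s.IsOutput G k → eA.eval s = G'.numA)
    (hB : ∀ s : State, s.IsOutput G k → eB.eval s = G'.numB)
    (hAdj : ∀ s : State, s.IsOutput G k → ∀ i j, s.var 3 = (i : Fin G'.numA).val →
      s.var 4 = (j : Fin G'.numB).val → eAdj.eval s = if G'.adj i j = true then 1 else 0)
    (hN₁ : G'.numA ≤ N) (hN₂ : G'.numB ≤ N) (hN₃ : G'.numA * G'.numB ≤ N) :
    Exec (outputGraph eA eB eAdj) s (outputGraphCost eA eB eAdj N)
      fun s' => s'.IsOutput G' k ∧ s'.BoundedBy N := by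
  refine (exec_assign uA hN).seq fun s₁ h₁ => ?_
  have o₁ := (hs.setVar (x := 5) (by omega) (eA.eval s)).of_agree h₁ (by omega)
  have b₁ := (hN.setVar (x := 5) (w := eA.eval s) (by rw [hA s hs]; exact hN₁)).of_agree h₁ le_rfl
  refine (exec_assign uB b₁).seq fun s₂ h₂ => ?_
  have o₂ := (o₁.setVar (x := 6) (by omega) (eB.eval s₁)).of_agree h₂ (by omega)
  have b₂ := (b₁.setVar (x := 6) (w := eB.eval s₁) (by rw [hB s₁ o₁]; exact hN₂)).of_agree h₂ le_rfl
  have h25 : s₂.var 5 = G'.numA := by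
    rw [h₂.1 5 (by omega), State.setVar_var, if_neg (by omega), h₁.1 5 (by omega)]
    simp [hA s hs]
  have h26 : s₂.var 6 = G'.numB := by
    rw [h₂.1 6 (by omega)]
    simp [hB s₁ o₁]
  have h27 : (Expr.sum 9 5 (.var 6)).eval s₂ = G'.numA * G'.numB := by
    rw [Expr.eval_sum_const (by omega), h25, h26]
  refine (exec_assign (r := 0) (by decide) b₂).seq fun s₃ h₃ => ?_
  rw [h27] at h₃
  have o₃ := (o₂.setVar (x := 7) (by omega) _).of_agree h₃ (by omega)
  have b₃ := (b₂.setVar (x := 7) hN₃).of_agree h₃ le_rfl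
  have h35 : s₃.var 5 = G'.numA := by
    rw [h₃.1 5 (by omega), State.setVar_var, if_neg (by omega), h25]
  have h36 : s₃.var 6 = G'.numB := by
    rw [h₃.1 6 (by omega), State.setVar_var, if_neg (by omega), h26]
  have h37 : s₃.var 7 = G'.numA * G'.numB := by
    rw [h₃.1 7 (by omega), State.setVar_var, if_pos rfl]
  refine (exec_fill (r := 0) (by omega) (by omega) (by omega) (by omega)
    (by simp [entry, Expr.Uses, Expr.eq, uAdj]) b₃).seq fun s₄ h₄ => ?_
  obtain ⟨v₄, -, a₄, b₄⟩ := h₄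
  refine (exec_fill (r := 1) (by omega) (by omega) (by omega) (by omega) (by decide) b₄).seq
    fun s₅ h₅ => ?_
  obtain ⟨v₅, -, a₅, b₅⟩ := h₅
  have h55 : s₅.var 5 = G'.numA := by
    rw [v₅ 5 (by omega) (by omega), v₄ 5 (by omega) (by omega), h35]
  have h56 : s₅.var 6 = G'.numB := by
    rw [v₅ 6 (by omega) (by omega), v₄ 6 (by omega) (by omega), h36]
  have h52 : s₅.var 2 = k := by
    rw [v₅ 2 (by omega) (by omega), v₄ 2 (by omega) (by omega)]
    exact o₃.2.2.1
  refine (exec_assign (r := 0) (by decide) b₅).seq fun s₆ h₆ => ?_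
  have e₆ : (Expr.var 5).eval s₅ = G'.numA := h55
  rw [e₆] at h₆
  have b₆ := (b₅.setVar (x := 0) hN₁).of_agree h₆ le_rfl
  refine (exec_assign (r := 0) (by decide) b₆).mono le_rfl fun s₇ h₇ => ?_
  have e₇ : (Expr.var 6).eval s₆ = G'.numB := by
    rw [Expr.eval, h₆.1 6 (by omega), State.setVar_var, if_neg (by omega), h56]
  rw [e₇] at h₇
  refine ⟨⟨?_, ?_, ?_, fun i j => ?_⟩, (b₆.setVar (x := 1) hN₂).of_agree h₇ le_rfl⟩
  · rw [h₇.1 0 (by omega), State.setVar_var, if_neg (by omega), h₆.1 0 (by omega)]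
    simp
  · rw [h₇.1 1 (by omega)]
    simp
  · rw [h₇.1 2 (by omega), State.setVar_var, if_neg (by omega), h₆.1 2 (by omega),
      State.setVar_var, if_neg (by omega), h52]
  · have hlt : i.val * G'.numB + j.val < G'.numA * G'.numB := by
      have := i.2
      have := j.2
      nlinarith
    rw [h₇.2, State.setVar_arr, h₆.2, State.setVar_arr, a₅]
    · simp only [Expr.eval, State.setVar_var, if_true, State.setVar_arr]
      rw [a₄ _ (by rw [h37]; exact hlt), eval_entry o₃ hAdj h35 h36]
    · rw [v₄ 7 (by omega) (by omega), h37]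
      exact hlt

end RAM

/-! ### The reduced graph -/

/-- An expression can count predecessors but not enumerate a set; this identifies the `i`-th kept
vertex as the one with `i` kept predecessors. -/
theorem card_filter_lt_orderEmbOfFin {n m : ℕ} (s : Finset (Fin n)) (h : s.card = m) (i : Fin m) :
    (s.filter fun x => x < s.orderEmbOfFin h i).card = i := by
  have : s.filter (fun x => x < s.orderEmbOfFin h i) =
      (Finset.Iio i).map (s.orderEmbOfFin h).toEmbedding := by
    ext x
    simp only [Finset.mem_filter, Finset.mem_map, Finset.mem_Iio, RelEmbedding.coe_toEmbedding]
    constructor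
    · rintro ⟨hx, hlt⟩
      obtain ⟨j, rfl⟩ : x ∈ Set.range (s.orderEmbOfFin h) := by simpa using hx
      exact ⟨j, by simpa using hlt, rfl⟩
    · rintro ⟨j, hj, rfl⟩
      exact ⟨s.orderEmbOfFin_mem h j, by simpa using hj⟩
  rw [this, Finset.card_map, Fin.card_Iio]

/-- The subgraph induced on the vertices that are kept. -/
def reduction (G : BipGraph) (k : ℕ) : BipGraph where
  numA := (Finset.univ.filter (KeepA G.adj k)).card
  numB := (Finset.univ.filter (KeepB G.adj k)).card
  adj i j := G.adj ((Finset.univ.filter (KeepA G.adj k)).orderEmbOfFin rfl i)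
    ((Finset.univ.filter (KeepB G.adj k)).orderEmbOfFin rfl j)

theorem bceovs_reduction (G : BipGraph) (k : ℕ) : BCEOVS (reduction G k) k ↔ BCEOVS G k := by
  rw [bceovs_iff_solvable, bceovs_iff_solvable]
  refine ⟨fun h => h.of_keep (RelEmbedding.injective _) (RelEmbedding.injective _) ?_ ?_,
    fun h => Solvable.comap (ι := (Finset.univ.filter (KeepA G.adj k)).orderEmbOfFin rfl)
      (κ := (Finset.univ.filter (KeepB G.adj k)).orderEmbOfFin rfl) (RelEmbedding.injective _)
      (RelEmbedding.injective _) h⟩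
  · intro a ha
    have : a ∈ Set.range ((Finset.univ.filter (KeepA G.adj k)).orderEmbOfFin rfl) := by simpa using ha
    exact this
  · intro b hb
    have : b ∈ Set.range ((Finset.univ.filter (KeepB G.adj k)).orderEmbOfFin rfl) := by simpa using hb
    exact this

theorem order_reduction_le (G : BipGraph) (k : ℕ) : (reduction G k).order ≤ G.order := by
  refine Nat.add_le_add ?_ ?_
  · exact (Finset.card_le_univ (Finset.univ.filter (KeepA G.adj k))).trans (Fintype.card_fin _).le
  · exact (Finset.card_le_univ (Finset.univ.filter (KeepB G.adj k))).trans (Fintype.card_fin _).le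

theorem order_reduction_le_of_bceovs {G : BipGraph} {k : ℕ} (hk : 0 < k) (h : BCEOVS G k) :
    (reduction G k).order ≤ 14 * k ^ 2 :=
  ((bceovs_iff_solvable G k).1 h).card_keep_le hk

/-! ### The reduction as an arithmetic expression -/

namespace RAM.Expr

/-- The entry of the biadjacency matrix in row `var x` and column `var y`. -/
def adj (x y : ℕ) : Expr := .read 0 (.add (.sum 10 x (.var 1)) (.var y))

/-- The absolute difference. -/
def dist (e e' : Expr) : Expr := .add (.sub e e') (.sub e' e)

/-- The number of neighbors that distinguish the vertices `var x` and `var x'` of `A`. -/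
def diffA (x x' : ℕ) : Expr := .sum 11 1 (dist (adj x 11) (adj x' 11))

/-- The number of neighbors that distinguish the vertices `var y` and `var y'` of `B`. -/
def diffB (y y' : ℕ) : Expr := .sum 14 0 (dist (adj 14 y) (adj 14 y'))

/-- This vanishes iff the component of `var x` is a biclique. -/
def nonBicliqueA (x : ℕ) : Expr :=
  .sum 12 1 <| .sum 13 0 <| .ite (adj x 12) (.ite (adj 13 12) (diffA 13 x) (.const 0)) (.const 0)

/-- This vanishes iff the component of `var y` is a biclique. -/
def nonBicliqueB (y : ℕ) : Expr := .sum 15 0 <| .ite (adj 15 y) (nonBicliqueA 15) (.const 0)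

/-- Is the vertex `var x` of `A` kept? -/
def keepA (x : ℕ) : Expr :=
  .ite (nonBicliqueA x)
    (.sub (.const 1) (.sub (.sum 16 x (.sub (.const 1) (diffA 16 x))) (.var 2))) (.const 0)

/-- Is the vertex `var y` of `B` kept? -/
def keepB (y : ℕ) : Expr :=
  .ite (nonBicliqueB y)
    (.sub (.const 1) (.sub (.sum 17 y (.sub (.const 1) (diffB 17 y))) (.var 2))) (.const 0)

/-- The adjacency of the vertices with the indices `var 3` and `var 4` among those that are kept. -/
def reducedAdj : Expr :=
  .sum 22 0 <| .ite (keepA 22) (.ite (.eq (.sum 20 22 (keepA 20)) (.var 3))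
    (.sum 23 1 <| .ite (keepB 23) (.ite (.eq (.sum 21 23 (keepB 21)) (.var 4)) (adj 22 23)
      (.const 0)) (.const 0)) (.const 0)) (.const 0)

variable {G : BipGraph} {k : ℕ} {s : State}

theorem eval_adj (hs : s.IsOutput G k) {x y : ℕ} (a : Fin G.numA) (b : Fin G.numB)
    (ha : s.var x = a) (hb : s.var y = b) :
    (adj x y).eval s = if G.adj a b = true then 1 else 0 := by
  rw [adj, eval, eval, eval_sum_const (by omega), ← hs.2.2.2 a b]
  simp [eval, ha, hb, hs.2.1]

theorem eval_dist_eq_zero {e e' : Expr} {p q : Prop} [Decidable p] [Decidable q]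
    (h : e.eval s = if p then 1 else 0) (h' : e'.eval s = if q then 1 else 0) :
    (dist e e').eval s = if (p ↔ q) then 0 else 1 := by
  simp only [dist, eval, h, h']
  by_cases hp : p <;> by_cases hq : q <;> simp [hp, hq]

/-- Here and below, the inequalities between variable names prevent the index of an inner sum from
overwriting a variable that is still needed. -/
theorem eval_diffA (hs : s.IsOutput G k) {x x' : ℕ} (hx : x ≠ 11) (hx' : x' ≠ 11)
    (a a' : Fin G.numA) (ha : s.var x = a) (ha' : s.var x' = a') :
    (diffA x x').eval s = 0 ↔ TwinA G.adj a a' := by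
  rw [diffA, eval_sum (n := G.numB) _ hs.2.1 fun b => eval_dist_eq_zero
    (eval_adj (hs.setVar (by omega) _) a b (by simp [ha, hx]) (by simp))
    (eval_adj (hs.setVar (by omega) _) a' b (by simp [ha', hx']) (by simp))]
  simp [TwinA, funext_iff, Finset.sum_eq_zero_iff]

theorem eval_diffB (hs : s.IsOutput G k) {y y' : ℕ} (hy : y ≠ 14) (hy' : y' ≠ 14)
    (b b' : Fin G.numB) (hb : s.var y = b) (hb' : s.var y' = b') :
    (diffB y y').eval s = 0 ↔ TwinB G.adj b b' := by
  rw [diffB, eval_sum (n := G.numA) _ hs.1 fun a => eval_dist_eq_zero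
    (eval_adj (hs.setVar (by omega) _) a b (by simp) (by simp [hb, hy]))
    (eval_adj (hs.setVar (by omega) _) a b' (by simp) (by simp [hb', hy']))]
  simp [TwinB, Finset.sum_eq_zero_iff]

theorem eval_nonBicliqueA (hs : s.IsOutput G k) {x : ℕ} (hx : x ≠ 11 ∧ x ≠ 12 ∧ x ≠ 13)
    (a : Fin G.numA) (ha : s.var x = a) :
    (nonBicliqueA x).eval s = 0 ↔ BicliqueA G.adj a := by
  rw [nonBicliqueA, eval_sum (n := G.numB) _ hs.2.1 fun b => eval_sum (n := G.numA) _
    (by simpa using hs.1) fun a' => rfl]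
  simp only [Finset.sum_eq_zero_iff, Finset.mem_univ, forall_true_left, BicliqueA]
  refine forall_congr' fun b => forall_congr' fun a' => ?_
  set s' := (s.setVar 12 b).setVar 13 a' with hs'
  have o : s'.IsOutput G k := (hs.setVar (by omega) _).setVar (by omega) _
  rw [eval_ite, eval_ite, eval_adj o a b (by simp [hs', hx, ha]) (by simp [hs']),
    eval_adj o a' b (by simp [hs']) (by simp [hs']),
    ← eval_diffA o (x := 13) (x' := x) (by omega) (by omega) a' a (by simp [hs'])
      (by simp [hs', hx, ha])]
  by_cases h1 : G.adj a b = true <;> by_cases h2 : G.adj a' b = true <;> simp [h1, h2, eval]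

theorem eval_nonBicliqueB (hs : s.IsOutput G k) {y : ℕ} (hy : y ≠ 15)
    (b : Fin G.numB) (hb : s.var y = b) :
    (nonBicliqueB y).eval s = 0 ↔ BicliqueB G.adj b := by
  rw [nonBicliqueB, eval_sum (n := G.numA) _ hs.1 fun a => rfl]
  simp only [Finset.sum_eq_zero_iff, Finset.mem_univ, forall_true_left, BicliqueB]
  refine forall_congr' fun a => ?_
  have o : (s.setVar 15 a).IsOutput G k := hs.setVar (by omega) _
  rw [eval_ite, eval_adj o a b (by simp) (by simp [hy, hb]),
    ← eval_nonBicliqueA o (x := 15) (by omega) a (by simp)]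
  by_cases h1 : G.adj a b = true <;> simp [h1, eval]

theorem eval_sum_lt {n x y : ℕ} {e : Expr} (p : Fin n → Prop) [DecidablePred p] (a : Fin n)
    (ha : s.var y = a) (h : ∀ a', a' < a → e.eval (s.setVar x a') = if p a' then 1 else 0) :
    (Expr.sum x y e).eval s = (Finset.univ.filter fun a' => a' < a ∧ p a').card := by
  rw [eval_sum (n := a) (fun i => if p ⟨i, i.2.trans a.2⟩ then 1 else 0) ha
    fun i => h ⟨i, i.2.trans a.2⟩ i.2, ← Finset.card_filter]
  refine Finset.card_bij (fun i _ => ⟨i, i.2.trans a.2⟩) ?_ ?_ ?_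
  · intro i hi
    simpa using ⟨i.2, by simpa using hi⟩
  · intro i _ j _ h
    simpa [Fin.ext_iff] using h
  · intro b hb
    simp only [Finset.mem_filter, Finset.mem_univ, true_and] at hb
    exact ⟨⟨b, hb.1⟩, by simpa using hb.2, rfl⟩

theorem one_sub_eq_ite {n : ℕ} {p : Prop} [Decidable p] (h : n = 0 ↔ p) :
    1 - n = if p then 1 else 0 := by
  split_ifs <;> simp_all
  omega

theorem eval_keepA (hs : s.IsOutput G k) {x : ℕ} (hx : x ≠ 11 ∧ x ≠ 12 ∧ x ≠ 13 ∧ x ≠ 16)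
    (a : Fin G.numA) (ha : s.var x = a) :
    (keepA x).eval s = if KeepA G.adj k a then 1 else 0 := by
  have h1 := eval_nonBicliqueA hs (x := x) (by omega) a ha
  have h2 := eval_sum_lt (x := 16) (e := .sub (.const 1) (diffA 16 x))
    (fun a' => TwinA G.adj a' a) a ha fun a' _ => one_sub_eq_ite
      (eval_diffA (hs.setVar (by omega) _) (by omega) (by omega) a' a (by simp) (by simp [hx, ha]))
  rw [keepA, eval_ite, eval, eval, eval, eval, h2, show (Expr.var 2).eval s = k from hs.2.2.1,
    one_sub_eq_ite Nat.sub_eq_zero_iff_le]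
  by_cases h : BicliqueA G.adj a <;> simp [KeepA, h1, h]

theorem eval_keepB (hs : s.IsOutput G k) {y : ℕ} (hy : y ≠ 14 ∧ y ≠ 15 ∧ y ≠ 17)
    (b : Fin G.numB) (hb : s.var y = b) :
    (keepB y).eval s = if KeepB G.adj k b then 1 else 0 := by
  have h1 := eval_nonBicliqueB hs (y := y) (by omega) b hb
  have h2 := eval_sum_lt (x := 17) (e := .sub (.const 1) (diffB 17 y))
    (fun b' => TwinB G.adj b' b) b hb fun b' _ => one_sub_eq_ite
      (eval_diffB (hs.setVar (by omega) _) (by omega) (by omega) b' b (by simp) (by simp [hy, hb]))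
  rw [keepB, eval_ite, eval, eval, eval, eval, h2, show (Expr.var 2).eval s = k from hs.2.2.1,
    one_sub_eq_ite Nat.sub_eq_zero_iff_le]
  by_cases h : BicliqueB G.adj b <;> simp [KeepB, h1, h]

theorem eval_reducedNumA (hs : s.IsOutput G k) :
    (Expr.sum 18 0 (keepA 18)).eval s = (reduction G k).numA := by
  rw [eval_sum _ hs.1 fun a => eval_keepA (hs.setVar (by omega) _) (by omega) a (by simp),
    ← Finset.card_filter]
  rfl

theorem eval_reducedNumB (hs : s.IsOutput G k) :
    (Expr.sum 19 1 (keepB 19)).eval s = (reduction G k).numB := by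
  rw [eval_sum _ hs.2.1 fun b => eval_keepB (hs.setVar (by omega) _) (by omega) b (by simp),
    ← Finset.card_filter]
  rfl

/-- Ranks are distinct, so a single term of the sum survives. This lets a sum select the `i`-th kept
vertex. -/
theorem sum_ite_rank {n : ℕ} (p : Fin n → Prop) [DecidablePred p]
    (i : Fin (Finset.univ.filter p).card) (F : Fin n → ℕ) :
    (∑ a, if p a then (if (Finset.univ.filter fun a' => a' < a ∧ p a').card = i then F a else 0)
      else 0) = F ((Finset.univ.filter p).orderEmbOfFin rfl i) := by
  have hr : ∀ i, (Finset.univ.filter fun a' =>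
      a' < (Finset.univ.filter p).orderEmbOfFin rfl i ∧ p a').card = i := by
    intro i
    have := card_filter_lt_orderEmbOfFin (Finset.univ.filter p) rfl i
    simpa only [Finset.filter_filter, and_comm] using this
  rw [Finset.sum_eq_single ((Finset.univ.filter p).orderEmbOfFin rfl i)]
  · have h1 : p ((Finset.univ.filter p).orderEmbOfFin rfl i) := by
      exact (Finset.mem_filter.1 ((Finset.univ.filter p).orderEmbOfFin_mem rfl i)).2
    rw [if_pos h1, if_pos (hr i)]
  · intro a _ ha
    split_ifs with h1 h2
    · obtain ⟨j, rfl⟩ : a ∈ Set.range ((Finset.univ.filter p).orderEmbOfFin rfl) := by simpa using h1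
      rw [hr j, Fin.val_inj] at h2
      exact absurd (by rw [h2]) ha
    · rfl
    · rfl
  · simp

theorem eval_reducedAdj (hs : s.IsOutput G k) (i : Fin (reduction G k).numA)
    (j : Fin (reduction G k).numB) (hi : s.var 3 = i) (hj : s.var 4 = j) :
    reducedAdj.eval s = if (reduction G k).adj i j = true then 1 else 0 := by
  change _ = if G.adj ((Finset.univ.filter (KeepA G.adj k)).orderEmbOfFin rfl i)
    ((Finset.univ.filter (KeepB G.adj k)).orderEmbOfFin rfl j) = true then 1 else 0
  rw [reducedAdj, eval_sum (n := G.numA) (fun a => if KeepA G.adj k a then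
    (if (Finset.univ.filter fun a' => a' < a ∧ KeepA G.adj k a').card = i then
      (∑ b, if KeepB G.adj k b then
        (if (Finset.univ.filter fun b' => b' < b ∧ KeepB G.adj k b').card = j then
          (if G.adj a b = true then 1 else 0) else 0) else 0) else 0) else 0) hs.1 ?_]
  · rw [sum_ite_rank (KeepA G.adj k) i, sum_ite_rank (KeepB G.adj k) j]
  · intro a
    have o : (s.setVar 22 a).IsOutput G k := hs.setVar (by omega) _
    rw [eval_ite, eval_keepA o (by omega) a (by simp), eval_ite, eval_eq,
      eval_sum_lt (KeepA G.adj k) a (by simp) fun a' _ =>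
        eval_keepA (o.setVar (by omega) _) (by omega) a' (by simp),
      show (Expr.var 3).eval (s.setVar 22 a) = i by simp [eval, hi],
      eval_sum (n := G.numB) (fun b => if KeepB G.adj k b then
        (if (Finset.univ.filter fun b' => b' < b ∧ KeepB G.adj k b').card = j then
          (if G.adj a b = true then 1 else 0) else 0) else 0) o.2.1 ?_]
    · simp only [ne_eq, ite_eq_right_iff, one_ne_zero, imp_false, not_not, eval]
    · intro b
      have o' : ((s.setVar 22 a).setVar 23 b).IsOutput G k := o.setVar (by omega) _
      rw [eval_ite, eval_keepB o' (by omega) b (by simp), eval_ite, eval_eq,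
        eval_sum_lt (KeepB G.adj k) b (by simp) fun b' _ =>
          eval_keepB (o'.setVar (by omega) _) (by omega) b' (by simp),
        show (Expr.var 4).eval ((s.setVar 22 a).setVar 23 b) = j by simp [eval, hj],
        eval_adj o' a b (by simp) (by simp)]
      simp only [ne_eq, ite_eq_right_iff, one_ne_zero, imp_false, not_not, eval]

end RAM.Expr

/-! ### Polynomial time bounds and the kernelization program -/

/-- `f` is bounded by a polynomial. -/
def PolyBounded (f : ℕ → ℕ) : Prop := ∃ C D, ∀ N, f N ≤ C * (N + 1) ^ D

theorem PolyBounded.add {f g : ℕ → ℕ} (hf : PolyBounded f) (hg : PolyBounded g) :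
    PolyBounded fun N => f N + g N := by
  obtain ⟨C, D, h⟩ := hf
  obtain ⟨C', D', h'⟩ := hg
  refine ⟨C + C', D + D', fun N => ?_⟩
  rw [Nat.add_mul]
  exact Nat.add_le_add ((h N).trans (RAM.cost_le_of_deg_le (Nat.le_add_right _ _)))
    ((h' N).trans (RAM.cost_le_of_deg_le (Nat.le_add_left _ _)))

theorem PolyBounded.const (c : ℕ) : PolyBounded fun _ => c := ⟨c, 0, fun N => by simp⟩

theorem PolyBounded.mul_pow (C D : ℕ) : PolyBounded fun N => C * (N + 1) ^ D :=
  ⟨C, D, fun _ => le_rfl⟩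

namespace RAM

theorem Expr.polyBounded_cost (e : Expr) : PolyBounded e.cost := .mul_pow _ _

theorem polyBounded_outputGraphCost (eA eB eAdj : Expr) :
    PolyBounded (outputGraphCost eA eB eAdj) :=
  .add (eA.polyBounded_cost.add (.const 2)) <| .add (eB.polyBounded_cost.add (.const 2)) <|
  .add ((Expr.polyBounded_cost _).add (.const 2)) <| .add (.mul_pow _ _) <| .add (.mul_pow _ _) <|
  .add ((Expr.polyBounded_cost _).add (.const 2)) ((Expr.polyBounded_cost _).add (.const 2))

/-- The program that replaces the instance in the memory by the graph without solution. -/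
def outputNo : Prog :=
  outputGraph (.const 2) (.add (.add (.var 2) (.var 2)) (.const 2))
    (.ite (.var 3) (.sub (.const 1) (.sub (.const 1) (.sub (.var 4) (.var 2)))) (.const 1))

/-- The time bound for `outputNo`. -/
def outputNoCost : ℕ → ℕ :=
  outputGraphCost (.const 2) (.add (.add (.var 2) (.var 2)) (.const 2))
    (.ite (.var 3) (.sub (.const 1) (.sub (.const 1) (.sub (.var 4) (.var 2)))) (.const 1))

/-- The biadjacency matrix of `noInstance k` has `2 * (2 * k + 2) = 4 * k + 4` entries, which
explains the requirement on `N`. -/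
theorem exec_outputNo {G : BipGraph} {k N : ℕ} {s : State} (hs : s.IsOutput G k)
    (hN : s.BoundedBy N) (hk : 4 * k + 4 ≤ N) :
    Exec outputNo s (outputNoCost N) fun s' => s'.IsOutput (noInstance k) k ∧ s'.BoundedBy N := by
  refine exec_outputGraph hs hN (by decide) (by decide) (by decide) (fun s _ => rfl)
    (fun s hs => ?_) (fun s hs i j hi hj => ?_) ?_ ?_ ?_
  · simp only [Expr.eval, hs.2.2.1, noInstance]
    omega
  · simp only [Expr.eval, hi, hj, hs.2.2.1, noInstance, decide_eq_true_eq]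
    split_ifs <;> omega
  all_goals simp only [noInstance]; omega

/-- The program that replaces the graph in the memory by its reduction. -/
def reduceGraph : Prog :=
  outputGraph (.sum 18 0 (Expr.keepA 18)) (.sum 19 1 (Expr.keepB 19)) Expr.reducedAdj

/-- The time bound for `reduceGraph`. -/
def reduceGraphCost : ℕ → ℕ :=
  outputGraphCost (.sum 18 0 (Expr.keepA 18)) (.sum 19 1 (Expr.keepB 19)) Expr.reducedAdj

theorem exec_reduceGraph {G : BipGraph} {k N : ℕ} {s : State} (hs : s.IsOutput G k)
    (hN : s.BoundedBy N) (hGN : G.order ^ 2 ≤ N) :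
    Exec reduceGraph s (reduceGraphCost N) fun s' =>
      s'.IsOutput (reduction G k) k ∧ s'.BoundedBy N := by
  have h1 := order_reduction_le G k
  have h2 : (reduction G k).order ^ 2 ≤ N := (Nat.pow_le_pow_left h1 2).trans hGN
  have h3 := Nat.le_self_pow (two_ne_zero) (reduction G k).order
  have h4 : (reduction G k).order = (reduction G k).numA + (reduction G k).numB := rfl
  refine exec_outputGraph hs hN (by decide) (by decide) (by decide)
    (fun s hs => Expr.eval_reducedNumA hs) (fun s hs => Expr.eval_reducedNumB hs)
    (fun s hs i j hi hj => Expr.eval_reducedAdj hs i j hi hj) (by omega) (by omega) ?_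
  refine le_trans ?_ h2
  rw [h4]
  nlinarith

/-- The program that computes an equivalent instance with at most `14 * k ^ 2` vertices. -/
def kernelize : Prog :=
  .seq reduceGraph <|
  .seq (assign 9 (.sub (.add (.var 0) (.var 1)) (.sum 10 2 (.sum 11 2 (.const 14))))) <|
  .ite 9 outputNo (.const 9 0)

/-- The time bound for `kernelize`. -/
def kernelizeCost (N : ℕ) : ℕ :=
  reduceGraphCost N +
    (((Expr.sub (.add (.var 0) (.var 1)) (.sum 10 2 (.sum 11 2 (.const 14)))).cost N + 2) +
      (outputNoCost N + 1 + 1))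

theorem polyBounded_kernelizeCost : PolyBounded kernelizeCost :=
  (polyBounded_outputGraphCost _ _ _).add (((Expr.polyBounded_cost _).add (.const 2)).add
    (((polyBounded_outputGraphCost _ _ _).add (.const 1)).add (.const 1)))

/-- The bound `8 * (G.order + k) ^ 2` dominates the input, the matrix of the reduced graph and, as
`k` is positive, the `4 * k + 4` entries for the no-instance. That instance has `2 * k + 4 ≤ 14 * k
^ 2` vertices. -/
theorem exec_kernelize (G : BipGraph) {k : ℕ} (hk : 0 < k) :
    Exec kernelize (State.input G k) (kernelizeCost (8 * (G.order + k) ^ 2)) fun s' =>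
      ∃ G', s'.IsOutput G' k ∧ s'.BoundedBy (8 * (G.order + k) ^ 2) ∧
        (BCEOVS G' k ↔ BCEOVS G k) ∧ G'.order ≤ 14 * k ^ 2 := by
  set Z := G.order + k with hZ
  have hZk : k ≤ Z := by omega
  have hZ1 : Z ≤ Z ^ 2 := Nat.le_self_pow two_ne_zero Z
  refine (exec_reduceGraph (State.input_isOutput G k)
    ((State.input_boundedBy G k).mono (by omega)) ?_).seq fun s₁ ⟨o₁, b₁⟩ => ?_
  · have := Nat.pow_le_pow_left (show G.order ≤ Z by omega) 2
    omega
  have hev : (Expr.sub (.add (.var 0) (.var 1)) (.sum 10 2 (.sum 11 2 (.const 14)))).eval s₁ =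
      (reduction G k).order - 14 * k ^ 2 := by
    simp only [Expr.eval, o₁.1, o₁.2.1, o₁.2.2.1, State.setVar_var, Finset.sum_const,
      Finset.card_range, BipGraph.order]
    simp
    ring_nf
  refine (exec_assign (r := 0) (by decide) b₁).seq fun s₂ h₂ => ?_
  rw [hev] at h₂
  have o₂ := (o₁.setVar (x := 9) (by omega) _).of_agree h₂ (by omega)
  have b₂ := (b₁.setVar (x := 9) (w := (reduction G k).order - 14 * k ^ 2)
    (by have := order_reduction_le G k; omega)).of_agree h₂ le_rfl
  have h29 : s₂.var 9 = (reduction G k).order - 14 * k ^ 2 := by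
    rw [h₂.1 9 (by omega)]
    simp
  refine Exec.ite (fun h => (exec_outputNo o₂ b₂ (by omega)).mono (by omega) ?_) fun h =>
    (Exec.const (Q := fun s' => s' = s₂.setVar 9 0) rfl).mono (by omega) ?_
  · rintro s₃ ⟨o₃, b₃⟩
    refine ⟨_, o₃, b₃, iff_of_false (not_bceovs_noInstance k) fun hG => ?_, ?_⟩
    · have := order_reduction_le_of_bceovs hk hG
      omega
    · simp only [BipGraph.order, noInstance]
      nlinarith
  · rintro s₃ rfl
    exact ⟨_, o₂.setVar (by omega) _, b₂.setVar (by omega), bceovs_reduction G k, by omega⟩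

end RAM

/-! ### Exhaustive search as an arithmetic expression -/

/-- The bit is set iff `X / 2 ^ p` is some odd `2 * q + 1`, that is, iff `X` lies in the interval of
length `2 ^ p` starting at `(2 * q + 1) * 2 ^ p`. The summand is the indicator of this interval, and
a suitable `q` is less than `X`. -/
theorem sum_testBit (X p : ℕ) :
    (∑ q ∈ Finset.range X, (1 - ((2 ^ p + q * (2 ^ p + 2 ^ p)) - X +
      ((X + 1) - (2 ^ p + q * (2 ^ p + 2 ^ p) + 2 ^ p))))) = (X.testBit p).toNat := by
  have hp : 0 < 2 ^ p := Nat.two_pow_pos p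
  have key : ∀ q, 1 - ((2 ^ p + q * (2 ^ p + 2 ^ p)) - X +
      ((X + 1) - (2 ^ p + q * (2 ^ p + 2 ^ p) + 2 ^ p))) =
      if X / 2 ^ p = 2 * q + 1 then 1 else 0 := by
    intro q
    have h1 : X / 2 ^ p = 2 * q + 1 ↔ 2 ^ p + q * (2 ^ p + 2 ^ p) ≤ X ∧
        X < 2 ^ p + q * (2 ^ p + 2 ^ p) + 2 ^ p := by
      have e : (2 * q + 1) * 2 ^ p = 2 ^ p + q * (2 ^ p + 2 ^ p) := by ring
      rw [← e]
      refine ⟨fun h => ?_, fun h => Nat.div_eq_of_lt_le h.1 ?_⟩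
      · rw [← h]
        exact ⟨Nat.div_mul_le_self _ _, Nat.lt_div_mul_add hp⟩
      · rw [Nat.succ_mul]
        exact h.2
    split_ifs with h <;> rw [h1] at h <;> omega
  simp only [key]
  have h2 : X / 2 ^ p ≤ X := Nat.div_le_self _ _
  by_cases h : X.testBit p = true
  · have h3 : X / 2 ^ p % 2 = 1 := by simpa [Nat.testBit_eq_decide_div_mod_eq] using h
    rw [Finset.sum_eq_single (X / 2 ^ p / 2), if_pos (by omega), h]
    · rfl
    · intro q _ hq
      rw [if_neg (by omega)]
    · intro hq
      rw [Finset.mem_range] at hq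
      omega
  · have h3 : ¬X / 2 ^ p % 2 = 1 := by simpa [Nat.testBit_eq_decide_div_mod_eq] using h
    rw [Bool.not_eq_true] at h
    rw [h]
    exact Finset.sum_eq_zero fun q _ => by rw [if_neg (by omega)]

namespace RAM.Expr

/-- The bit with the number `var p` of `var x`. -/
def bit (x p : ℕ) : Expr :=
  .sum 25 x <| .sub (.const 1) <|
    .add (.sub (.add (.pow2 p) (.sum 26 25 (.add (.pow2 p) (.pow2 p)))) (.var x))
      (.sub (.add (.var x) (.const 1))
        (.add (.add (.pow2 p) (.sum 26 25 (.add (.pow2 p) (.pow2 p)))) (.pow2 p)))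

/-- The bit of `var 24` at the position `e < var 7`. -/
def bitAt (e : Expr) : Expr := .sum 27 7 (.ite (.eq (.var 27) e) (bit 24 27) (.const 0))

/-- Is the vertex `var x` of `A` in the block `var i`? -/
def codeA (x i : ℕ) : Expr := bitAt (.add (.sum 28 x (.var 6)) (.var i))

/-- Is a copy of the vertex `var y` of `B` in the block `var i`? -/
def codeB (y i : ℕ) : Expr :=
  bitAt (.add (.add (.sum 28 0 (.var 6)) (.sum 28 y (.var 6))) (.var i))

/-- Is the adjacency of `var 29` and `var 31` changed in the solution with the code `var 24`? -/
def mismatch : Expr :=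
  .ite (.sum 30 6 (.ite (codeA 29 30) (codeB 31 30) (.const 0))) (.sub (.const 1) (adj 29 31))
    (adj 29 31)

/-- The numbers of violations and excess costs of the solution with the code `var 24`. -/
def defect : Expr :=
  .add
    (.add (.sum 29 0 (.add (.sub (.sum 30 6 (codeA 29 30)) (.const 1))
        (.sub (.const 1) (.sum 30 6 (codeA 29 30)))))
      (.sum 31 1 (.sub (.const 1) (.sum 30 6 (codeB 31 30)))))
    (.sub (.sum 31 1 (.add (.sub (.sum 30 6 (codeB 31 30)) (.const 1)) (.sum 29 0 mismatch)))
      (.var 2))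

/-- The answer, found by trying the codes below `var 8`. -/
def answer : Expr := .sub (.const 1) (.sub (.const 1) (.sum 24 8 (.sub (.const 1) defect)))

/-- The program variables that describe the size of the codes are set. -/
structure Setup (s : State) (G : BipGraph) (k X : ℕ) : Prop where
  isOutput : s.IsOutput G k
  var_six : s.var 6 = G.numA + 1
  var_seven : s.var 7 = (G.numA + G.numB) * (G.numA + 1)
  var_code : s.var 24 = X

variable {G : BipGraph} {k X : ℕ} {s : State}

theorem Setup.setVar (hs : Setup s G k X) {x : ℕ} (hx : 25 ≤ x) (v : ℕ) :
    Setup (s.setVar x v) G k X := by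
  have : 6 ≠ x ∧ 7 ≠ x ∧ 24 ≠ x := by omega
  exact ⟨hs.1.setVar (by omega) v, by simp [this, hs.2], by simp [this, hs.3],
    by simp [this, hs.4]⟩

theorem eval_bit {x p : ℕ} (hx : x ≠ 25) (hp : p ≠ 25 ∧ p ≠ 26) :
    (bit x p).eval s = ((s.var x).testBit (s.var p)).toNat := by
  rw [← sum_testBit]
  simp [bit, eval, hx, hp]

/-- `bit` expects its position in a variable. A computed position is therefore matched against all
values of `var 27` below the code length, and one of them agrees. -/
theorem eval_bitAt (hs : Setup s G k X) {e : Expr} {p : ℕ}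
    (hp : p < (G.numA + G.numB) * (G.numA + 1)) (he : ∀ i, e.eval (s.setVar 27 i) = p) :
    (bitAt e).eval s = (X.testBit p).toNat := by
  rw [bitAt, eval, hs.var_seven, Finset.sum_eq_single p]
  · rw [eval_ite, eval_eq, he, eval_bit (by omega) (by omega)]
    simp [eval, hs.var_code]
  · intro i _ hi
    rw [eval_ite, eval_eq, he]
    simp [eval, hi]
  · intro h
    exact absurd (Finset.mem_range.2 hp) h

theorem eval_codeA (hs : Setup s G k X) {x i : ℕ} (hx : x ≠ 27) (hi : i ≠ 27)
    (a : Fin G.numA) (j : Fin (G.numA + 1)) (ha : s.var x = a) (hj : s.var i = j) :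
    (codeA x i).eval s = (codeBit G.numA X a j).toNat := by
  refine eval_bitAt hs ?_ fun c => ?_
  · have h1 := j.2
    have h2 : (a.val + 1) * (G.numA + 1) ≤ (G.numA + G.numB) * (G.numA + 1) :=
      Nat.mul_le_mul_right _ (by omega)
    linarith
  · rw [eval, eval_sum_const (by omega)]
    simp [eval, hx, hi, ha, hj, hs.var_six]

theorem eval_codeB (hs : Setup s G k X) {y i : ℕ} (hy : y ≠ 27) (hi : i ≠ 27)
    (b : Fin G.numB) (j : Fin (G.numA + 1)) (hb : s.var y = b) (hj : s.var i = j) :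
    (codeB y i).eval s = (codeBit G.numA X (G.numA + b) j).toNat := by
  refine eval_bitAt hs ?_ fun c => ?_
  · have h1 := j.2
    have h2 : (G.numA + b.val + 1) * (G.numA + 1) ≤ (G.numA + G.numB) * (G.numA + 1) :=
      Nat.mul_le_mul_right _ (by omega)
    linarith
  · change ((Expr.sum 28 0 (.var 6)).eval _ + (Expr.sum 28 y (.var 6)).eval _) + _ = _
    rw [eval_sum_const (by omega), eval_sum_const (by omega)]
    simp [eval, hy, hi, hb, hj, hs.var_six, hs.isOutput.1]
    ring

theorem eval_sum_codeA (hs : Setup s G k X) (a : Fin G.numA) (ha : s.var 29 = a) :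
    (Expr.sum 30 6 (codeA 29 30)).eval s =
      ∑ i : Fin (G.numA + 1), (codeBit G.numA X a i).toNat :=
  eval_sum _ hs.var_six fun i =>
    eval_codeA (hs.setVar (by omega) _) (by omega) (by omega) a i (by simp [ha]) (by simp)

theorem eval_sum_codeB (hs : Setup s G k X) (b : Fin G.numB) (hb : s.var 31 = b) :
    (Expr.sum 30 6 (codeB 31 30)).eval s =
      ∑ i : Fin (G.numA + 1), (codeBit G.numA X (G.numA + b) i).toNat :=
  eval_sum _ hs.var_six fun i =>
    eval_codeB (hs.setVar (by omega) _) (by omega) (by omega) b i (by simp [hb]) (by simp)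

theorem eval_mismatch (hs : Setup s G k X) (a : Fin G.numA) (b : Fin G.numB)
    (ha : s.var 29 = a) (hb : s.var 31 = b) :
    mismatch.eval s = if (G.adj a b = true ↔ ∃ i : Fin (G.numA + 1),
      codeBit G.numA X a i = true ∧ codeBit G.numA X (G.numA + b) i = true) then 0 else 1 := by
  rw [mismatch, eval_ite, eval, eval_adj hs.isOutput a b ha hb,
    eval_sum (n := G.numA + 1) (fun i => if codeBit G.numA X a i = true ∧
      codeBit G.numA X (G.numA + b) i = true then 1 else 0) hs.var_six ?_]
  · have : (∑ i : Fin (G.numA + 1), (if codeBit G.numA X a i = true ∧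
        codeBit G.numA X (G.numA + b) i = true then 1 else 0)) ≠ 0 ↔
        ∃ i : Fin (G.numA + 1),
          codeBit G.numA X a i = true ∧ codeBit G.numA X (G.numA + b) i = true := by
      rw [Ne, Finset.sum_eq_zero_iff]
      simp
    rw [if_congr this rfl rfl]
    by_cases h : ∃ i : Fin (G.numA + 1),
      codeBit G.numA X a i = true ∧ codeBit G.numA X (G.numA + b) i = true <;>
    by_cases h' : G.adj a b = true <;> simp only [h, h', if_true, if_false, eval] <;> simp
  · intro i
    have hs' := hs.setVar (x := 30) (by omega) i
    rw [eval_ite, eval_codeA hs' (by omega) (by omega) a i (by simp [ha]) (by simp),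
      eval_codeB hs' (by omega) (by omega) b i (by simp [hb]) (by simp)]
    cases codeBit G.numA X a i <;> cases codeBit G.numA X (G.numA + b) i <;> simp [eval]

theorem eval_defect (hs : Setup s G k X) : defect.eval s = codeDefect G.adj k X := by
  rw [defect, codeDefect, relCost]
  change ((Expr.sum 29 0 _).eval s + (Expr.sum 31 1 _).eval s) +
    ((Expr.sum 31 1 _).eval s - (Expr.var 2).eval s) = _
  refine congrArg₂ _ (congrArg₂ _ ?_ ?_) (congrArg₂ _ ?_ ?_)
  · refine eval_sum _ hs.isOutput.1 fun a => ?_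
    have h := eval_sum_codeA (hs.setVar (x := 29) (by omega) a) a (by simp)
    change ((Expr.sum 30 6 (codeA 29 30)).eval _ - 1) +
      (1 - (Expr.sum 30 6 (codeA 29 30)).eval _) = _
    rw [h]
  · refine eval_sum _ hs.isOutput.2.1 fun b => ?_
    have h := eval_sum_codeB (hs.setVar (x := 31) (by omega) b) b (by simp)
    rw [eval, h]
    rfl
  · refine eval_sum _ hs.isOutput.2.1 fun b => ?_
    have hs' := hs.setVar (x := 31) (by omega) b
    have h := eval_sum_codeB hs' b (by simp)
    have h' := eval_sum (x := 29) (e := mismatch) _ hs'.isOutput.1 fun a =>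
      eval_mismatch (hs'.setVar (by omega) _) a b (by simp) (by simp)
    rw [eval, eval, h, h']
    rfl
  · exact hs.isOutput.2.2.1

/-- The summand `1 - defect` is the indicator of a valid code, and `1 - (1 - x)` turns the number of
valid codes into a truth value. -/
theorem eval_answer [Decidable (BCEOVS G k)] (hs : s.IsOutput G k) (h6 : s.var 6 = G.numA + 1)
    (h7 : s.var 7 = (G.numA + G.numB) * (G.numA + 1))
    (h8 : s.var 8 = 2 ^ ((G.numA + G.numB) * (G.numA + 1))) :
    answer.eval s = if BCEOVS G k then 1 else 0 := by
  have h : (Expr.sum 24 8 (.sub (.const 1) defect)).eval s ≠ 0 ↔ BCEOVS G k := by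
    have hX : ∀ X, (Expr.sub (.const 1) defect).eval (s.setVar 24 X) =
        1 - codeDefect G.adj k X := by
      intro X
      rw [eval, eval_defect (X := X) ⟨hs.setVar (by omega) _, by simp [h6], by simp [h7], by simp⟩]
      rfl
    rw [bceovs_iff_solvable, solvable_iff_exists_code, eval, h8, Ne, Finset.sum_eq_zero_iff]
    simp only [hX, Finset.mem_range, not_forall, exists_prop]
    refine exists_congr fun X => and_congr Iff.rfl ?_
    omega
  change 1 - (1 - (Expr.sum 24 8 (.sub (.const 1) defect)).eval s) = _
  split_ifs with h'
  · have := h.2 h'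
    omega
  · have := mt h.1 h'
    omega

end RAM.Expr

namespace RAM

/-- The program that computes the answer in the variable `9` by exhaustive search. -/
def search : Prog :=
  .seq (assign 6 (.add (.var 0) (.const 1))) <|
  .seq (assign 7 (.add (.sum 10 0 (.var 6)) (.sum 10 1 (.var 6)))) <|
  .seq (assign 8 (.pow2 7)) <| assign 9 Expr.answer

/-- The time bound for `search`. -/
def searchCost (N : ℕ) : ℕ :=
  ((Expr.add (.var 0) (.const 1)).cost N + 2) +
    (((Expr.add (.sum 10 0 (.var 6)) (.sum 10 1 (.var 6))).cost N + 2) +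
      (((Expr.pow2 7).cost N + 2) + (Expr.answer.cost N + 2)))

theorem polyBounded_searchCost : PolyBounded searchCost :=
  ((Expr.polyBounded_cost _).add (.const 2)).add <|
    ((Expr.polyBounded_cost _).add (.const 2)).add <|
    ((Expr.polyBounded_cost _).add (.const 2)).add ((Expr.polyBounded_cost _).add (.const 2))

/-- The number of codes is stored in the variable `8` as the range of a sum, so `N` has to dominate
it. The time is then polynomial in `N`, though not in the order of `G`. -/
theorem exec_search {G : BipGraph} {k N : ℕ} {s : State} [Decidable (BCEOVS G k)]
    (hs : s.IsOutput G k) (hN : s.BoundedBy N)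
    (h : 2 ^ (G.order * (G.order + 1)) ≤ N) :
    Exec search s (searchCost N) fun s' => s'.IsOutput G k ∧ s'.BoundedBy N ∧
      s'.var 9 = if BCEOVS G k then 1 else 0 := by
  set L := (G.numA + G.numB) * (G.numA + 1) with hL
  have hL1 : L ≤ G.order * (G.order + 1) :=
    Nat.mul_le_mul_left _ (Nat.add_le_add_right (Nat.le_add_right _ _) 1)
  have hL2 : 2 ^ L ≤ N := (Nat.pow_le_pow_right two_pos hL1).trans h
  have hL3 : L < 2 ^ L := Nat.lt_two_pow_self
  have hA : G.numA ≤ L := by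
    rw [hL]
    nlinarith
  refine (exec_assign (r := 0) (by decide) hN).seq fun s₁ h₁ => ?_
  have e₁ : (Expr.add (.var 0) (.const 1)).eval s = G.numA + 1 := by simp [Expr.eval, hs.1]
  rw [e₁] at h₁
  have o₁ := (hs.setVar (x := 6) (by omega) _).of_agree h₁ (by omega)
  have b₁ := (hN.setVar (x := 6) (show G.numA + 1 ≤ N by omega)).of_agree h₁ le_rfl
  have h16 : s₁.var 6 = G.numA + 1 := by
    rw [h₁.1 6 (by omega)]
    simp
  refine (exec_assign (r := 0) (by decide) b₁).seq fun s₂ h₂ => ?_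
  have e₂ : (Expr.add (.sum 10 0 (.var 6)) (.sum 10 1 (.var 6))).eval s₁ = L := by
    rw [Expr.eval, Expr.eval_sum_const (by omega), Expr.eval_sum_const (by omega), h16, o₁.1,
      o₁.2.1, hL, Nat.add_mul]
  rw [e₂] at h₂
  have o₂ := (o₁.setVar (x := 7) (by omega) _).of_agree h₂ (by omega)
  have b₂ := (b₁.setVar (x := 7) (show L ≤ N by omega)).of_agree h₂ le_rfl
  have h26 : s₂.var 6 = G.numA + 1 := by
    rw [h₂.1 6 (by omega)]
    simp [h16]
  have h27 : s₂.var 7 = L := by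
    rw [h₂.1 7 (by omega)]
    simp
  refine (exec_assign (r := 0) (by decide) b₂).seq fun s₃ h₃ => ?_
  have e₃ : (Expr.pow2 7).eval s₂ = 2 ^ L := by rw [Expr.eval, h27]
  rw [e₃] at h₃
  have o₃ := (o₂.setVar (x := 8) (by omega) _).of_agree h₃ (by omega)
  have b₃ := (b₂.setVar (x := 8) hL2).of_agree h₃ le_rfl
  have e₄ : Expr.answer.eval s₃ = if BCEOVS G k then 1 else 0 := by
    refine Expr.eval_answer o₃ ?_ ?_ ?_
    · rw [h₃.1 6 (by omega)]
      simp [h26]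
    · rw [h₃.1 7 (by omega)]
      simp [h27, hL]
    · rw [h₃.1 8 (by omega)]
      simp [hL]
  refine (exec_assign (r := 0) (by decide) b₃).mono le_rfl fun s₄ h₄ => ?_
  rw [e₄] at h₄
  refine ⟨(o₃.setVar (x := 9) (by omega) _).of_agree h₄ (by omega),
    (b₃.setVar (x := 9) ?_).of_agree h₄ le_rfl, ?_⟩
  · split_ifs <;> omega
  · rw [h₄.1 9 (by omega)]
    simp

end RAM

/-! ### The two algorithms and the main theorem -/

open RAM in
/-- The kernelization, followed by exhaustive search, with the answer in the variable `0`. -/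
def decideProg : Prog := .seq kernelize <| .seq search <| assign 0 (.var 9)

open RAM in
/-- The kernelization; instances with `k = 1` are solved. -/
def kernelProg : Prog :=
  .seq kernelize <| .seq (assign 9 (.sub (.var 2) (.const 1))) <|
  .ite 9 (.const 9 0) <|
  .seq search <| .ite 9 (.seq (assign 0 (.const 0)) (assign 1 (.const 0))) outputNo

/-- The number of codes to be tried. -/
def numCodes (k : ℕ) : ℕ := 2 ^ (14 * k ^ 2 * (14 * k ^ 2 + 1))

theorem pow_order_le_numCodes {G : BipGraph} {k : ℕ} (h : G.order ≤ 14 * k ^ 2) :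
    2 ^ (G.order * (G.order + 1)) ≤ numCodes k :=
  Nat.pow_le_pow_right two_pos (Nat.mul_le_mul h (Nat.add_le_add_right h 1))

namespace RAM

/-- The time bound for `decideProg`. -/
def decideCost (N : ℕ) : ℕ := kernelizeCost N + (searchCost N + ((Expr.var 9).cost N + 2))

theorem polyBounded_decideCost : PolyBounded decideCost :=
  polyBounded_kernelizeCost.add (polyBounded_searchCost.add
    ((Expr.polyBounded_cost _).add (.const 2)))

theorem kernelizeCost_mono {N N' : ℕ} (h : N ≤ N') : kernelizeCost N ≤ kernelizeCost N' := by
  have hc : ∀ e : Expr, e.cost N ≤ e.cost N' := fun e =>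
    Nat.mul_le_mul_left _ (Nat.pow_le_pow_left (Nat.add_le_add_right h 1) _)
  have hp : ∀ c D, c * (N + 1) ^ D ≤ c * (N' + 1) ^ D := fun c D =>
    Nat.mul_le_mul_left _ (Nat.pow_le_pow_left (Nat.add_le_add_right h 1) _)
  simp only [kernelizeCost, reduceGraphCost, outputNoCost, outputGraphCost]
  gcongr <;> exact hc _

theorem exec_decideProg (G : BipGraph) {k : ℕ} (hk : 0 < k) [Decidable (BCEOVS G k)] :
    Exec decideProg (State.input G k) (decideCost (8 * (G.order + k) ^ 2 + numCodes k))
      fun s' => s'.var 0 = if BCEOVS G k then 1 else 0 := by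
  classical
  refine ((exec_kernelize G hk).mono (kernelizeCost_mono (Nat.le_add_right _ _))
    fun _ h => h).seq fun s₁ ⟨G', o₁, b₁, hG', hord⟩ => ?_
  refine (exec_search o₁ (b₁.mono (Nat.le_add_right _ _))
    ((pow_order_le_numCodes hord).trans (Nat.le_add_left _ _))).seq fun s₂ ⟨o₂, b₂, h₂⟩ => ?_
  refine (exec_assign (r := 0) (by decide) b₂).mono le_rfl fun s₃ h₃ => ?_
  rw [h₃.1 0 (by omega), State.setVar_var, if_pos rfl, Expr.eval, h₂]
  exact if_congr hG' rfl rfl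

/-- The time bound for `kernelProg`. -/
def kernelCost (N : ℕ) : ℕ :=
  kernelizeCost N + (((Expr.sub (.var 2) (.const 1)).cost N + 2) +
    ((searchCost N + (((((Expr.const 0).cost N + 2) + ((Expr.const 0).cost N + 2)) +
      outputNoCost N) + 1)) + 1 + 1))

theorem polyBounded_kernelCost : PolyBounded kernelCost :=
  polyBounded_kernelizeCost.add <| ((Expr.polyBounded_cost _).add (.const 2)).add <|
    .add (.add (polyBounded_searchCost.add <| .add (.add (.add
      ((Expr.polyBounded_cost _).add (.const 2)) ((Expr.polyBounded_cost _).add (.const 2)))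
      (polyBounded_outputGraphCost _ _ _)) (.const 1)) (.const 1)) (.const 1)

/-- For `k ≥ 2`, `14 * k ^ 2 ≤ 7 * k ^ 5` because `2 ≤ k ^ 3`. For `k = 1` the bound `14` exceeds
`7`, so the search is run. It tries at most the constant number `numCodes 1` of codes, and its
answer becomes the empty graph or `noInstance 1`, which has six vertices. -/
theorem exec_kernelProg (G : BipGraph) {k : ℕ} (hk : 0 < k) :
    Exec kernelProg (State.input G k) (kernelCost (8 * (G.order + k) ^ 2 + numCodes 1))
      fun s' => ∃ G', s'.IsOutput G' k ∧ (BCEOVS G' k ↔ BCEOVS G k) ∧ G'.order ≤ 7 * k ^ 5 := by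
  classical
  set N := 8 * (G.order + k) ^ 2 + numCodes 1 with hN
  have hZ : 8 * k ≤ N := by
    have h1 := Nat.le_self_pow two_ne_zero (G.order + k)
    omega
  refine ((exec_kernelize G hk).mono (kernelizeCost_mono (Nat.le_add_right _ _))
    fun _ h => h).seq fun s₁ ⟨G', o₁, b₁, hG', hord⟩ => ?_
  have b₁ : s₁.BoundedBy N := b₁.mono (Nat.le_add_right _ _)
  refine (exec_assign (r := 0) (by decide) b₁).seq fun s₂ h₂ => ?_
  have e₂ : (Expr.sub (.var 2) (.const 1)).eval s₁ = k - 1 := by simp [Expr.eval, o₁.2.2.1]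
  rw [e₂] at h₂
  have o₂ := (o₁.setVar (x := 9) (by omega) _).of_agree h₂ (by omega)
  have b₂ := (b₁.setVar (x := 9) (show k - 1 ≤ N by omega)).of_agree h₂ le_rfl
  have h29 : s₂.var 9 = k - 1 := by
    rw [h₂.1 9 (by omega)]
    simp
  refine Exec.ite (fun h => (Exec.const (Q := fun s' => s' = s₂.setVar 9 0) rfl).mono (by omega) ?_)
    fun h => ?_
  · rintro s₃ rfl
    refine ⟨G', o₂.setVar (by omega) _, hG', hord.trans ?_⟩
    have h2 : 2 ≤ k := by omega
    have h8 : 2 ^ 3 ≤ k ^ 3 := Nat.pow_le_pow_left h2 3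
    calc 14 * k ^ 2 ≤ 7 * (k ^ 2 * k ^ 3) := by nlinarith
      _ = 7 * k ^ 5 := by ring
  · obtain rfl : k = 1 := by omega
    refine (exec_search o₂ b₂ ((pow_order_le_numCodes hord).trans (Nat.le_add_left _ _))).seq
      (c' := (((Expr.const 0).cost N + 2) + ((Expr.const 0).cost N + 2)) + outputNoCost N + 1)
      (fun s₃ ⟨o₃, b₃, h₃⟩ => Exec.ite (fun h' => ?_) fun h' => ?_) |>.mono (by omega) fun _ h => h
    · have hy : BCEOVS G' 1 := by
        by_contra hn
        rw [h₃, if_neg hn] at h'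
        exact h' rfl
      refine ((exec_assign (r := 0) (e := .const 0) (by decide) b₃).seq
        (Q' := fun s' => s'.IsOutput ⟨0, 0, fun _ _ => false⟩ 1) fun s₄ h₄ =>
        (exec_assign (r := 0) (e := .const 0) (by decide)
          ((b₃.setVar (Nat.zero_le _)).of_agree h₄ le_rfl)).mono le_rfl fun s₅ h₅ => ?_).mono
          (Nat.le_add_right _ _) fun s₅ h₅ => ?_
      · refine ⟨?_, ?_, ?_, fun a => a.elim0⟩
        · rw [h₅.1 0 (by omega), State.setVar_var, if_neg (by omega), h₄.1 0 (by omega)]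
          simp [Expr.eval]
        · rw [h₅.1 1 (by omega)]
          simp [Expr.eval]
        · rw [h₅.1 2 (by omega), State.setVar_var, if_neg (by omega), h₄.1 2 (by omega),
            State.setVar_var, if_neg (by omega)]
          exact o₃.2.2.1
      · exact ⟨_, h₅, iff_of_true (bceovs_of_isEmpty Fin.isEmpty' _) (hG'.1 hy), Nat.zero_le _⟩
    · have hn : ¬BCEOVS G' 1 := by
        intro hy
        rw [h₃, if_pos hy] at h'
        exact one_ne_zero h'
      refine (exec_outputNo o₃ b₃ (by omega)).mono (Nat.le_add_left _ _) fun s₄ ⟨o₄, _⟩ => ?_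
      refine ⟨_, o₄, iff_of_false (not_bceovs_noInstance 1) (mt hG'.2 hn), ?_⟩
      simp [BipGraph.order, noInstance]

end RAM

/-- For positive `Z`, `8 * Z ^ 2 + m + 1 ≤ (m + 9) * Z ^ 2`. This separates the factor depending on
the parameter, contained in `m`, from the polynomial in the input size `Z`. -/
theorem PolyBounded.exists_bound {f : ℕ → ℕ} (hf : PolyBounded f) :
    ∃ C D, ∀ Z m, 0 < Z → f (8 * Z ^ 2 + m) ≤ C * (m + 9) ^ D * Z ^ (2 * D) := by
  obtain ⟨C, D, h⟩ := hf
  refine ⟨C, D, fun Z m hZ => (h _).trans ?_⟩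
  rw [Nat.mul_assoc, pow_mul, ← _root_.mul_pow]
  refine Nat.mul_le_mul_left _ (Nat.pow_le_pow_left ?_ _)
  have : 1 ≤ Z ^ 2 := Nat.one_le_pow _ _ hZ
  nlinarith

theorem primrec_pow : Primrec₂ fun m n : ℕ => m ^ n := Primrec₂.unpaired'.1 Nat.Primrec.pow

theorem primrec_numCodes : Primrec numCodes := by
  have h : Primrec fun k : ℕ => 14 * k ^ 2 :=
    Primrec.nat_mul.comp (Primrec.const 14) (primrec_pow.comp Primrec.id (Primrec.const 2))
  exact primrec_pow.comp (Primrec.const 2)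
    (Primrec.nat_mul.comp h (Primrec.nat_add.comp h (Primrec.const 1)))

theorem hasKernelWithVertices_bceovs : HasKernelWithVertices BCEOVS (fun k => 7 * k ^ 5) := by
  obtain ⟨C, D, h⟩ := RAM.polyBounded_kernelCost.exists_bound
  set K := C * (numCodes 1 + 9) ^ D with hK
  -- The same constant must serve as factor and as exponent. The sum works because the base `G.order
  -- + k` is at least `1`.
  refine ⟨kernelProg, K + 2 * D, fun G k hk => ?_⟩
  obtain ⟨n, s, h1, h2, G', h3, h4, h5⟩ := RAM.exec_kernelProg G hk
  refine ⟨n, s, G', h1, h2.trans ((h _ _ (by omega)).trans ?_), h3, h4, h5⟩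
  exact Nat.mul_le_mul (Nat.le_add_right _ _)
    (Nat.pow_le_pow_right (by omega) (Nat.le_add_left _ _))

theorem isFixedParameterTractable_bceovs : IsFixedParameterTractable BCEOVS := by
  classical
  obtain ⟨C, D, h⟩ := RAM.polyBounded_decideCost.exists_bound
  refine ⟨decideProg, fun k => C * (numCodes k + 9) ^ D, 2 * D, ?_, fun G k hk => ?_⟩
  · exact (Primrec.nat_mul.comp (Primrec.const C) (primrec_pow.comp
      (Primrec.nat_add.comp primrec_numCodes (Primrec.const 9)) (Primrec.const D))).to_comp
  · obtain ⟨n, s, h1, h2, h3⟩ := RAM.exec_decideProg G hk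
    exact ⟨n, s, h1, h2.trans (h _ _ (by omega)), fun hy => by rw [h3, if_pos hy],
      fun hn => by rw [h3, if_neg hn]⟩

theorem mainTheorem6 :
    HasKernelWithVertices BCEOVS (fun k => 7 * k ^ 5) ∧ IsFixedParameterTractable BCEOVS :=
  ⟨hasKernelWithVertices_bceovs, isFixedParameterTractable_bceovs⟩
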